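/- Let $K$ be a field. A transformation-pair $[\mu,\nu:E\to V]$ over $K$ consists of two $K$-linear maps $\mu,\nu:E\to V$ between finite-dimensional $K$-vector spaces. An isomorphism $[\mu,\nu:E\to V]\cong[\mu',\nu':E'\to V']$ is a pair of linear isomorphisms $\alpha:E\to E'$, $\beta:V\to V'$ with $\mu'\alpha=\beta\mu$ and $\nu'\alpha=\beta\nu$; direct sums are formed componentwise. A transformation-pair is indecomposable if it is non-zero and not isomorphic to a direct sum of two non-zero ones. For an indecomposable $\kappa$, the multiplicity $[\pi:\kappa]$ is the number of summands isomorphic to $\kappa$ in a decomposition of $\pi$ as a finite direct sum of indecomposables (such a decomposition exists, and the number is the same for all of them). Let $f_1^{(n)},\dots,f_n^{(n)}$ be the standard basis of $K^n$, let $I_n$ be the identity of $K^n$, and let $\mu_n:K^n\to K^n$ be the nilpotent map $f_1^{(n)}\mapsto f_2^{(n)}\mapsto\cdots\mapsto f_n^{(n)}\mapsto 0$. For $n\ge 1$ put ${}^0T_n=[\mu_n,I_n:K^n\to K^n]$ and $T_n^0=[I_n,\mu_n:K^n\to K^n]$, and let ${}^0T_n^0=[\kappa'_n,\lambda'_n:K^{n+1}\to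 K^n]$, where $\kappa'_n(f_i^{(n+1)})=f_i^{(n)}$ for $i\le n$, $\kappa'_n(f_{n+1}^{(n+1)})=0$, $\lambda'_n(f_1^{(n+1)})=0$, and $\lambda'_n(f_{i+1}^{(n+1)})=f_i^{(n)}$ for $1\le i\le n$. Write ${}^0t_n(\pi)=[\pi:{}^0T_n]$, $t_n^0(\pi)=[\pi:T_n^0]$ and ${}^0t_n^0(\pi)=[\pi:{}^0T_n^0]$. Let $\Gamma=(R,S)$ be a finite binary relation, i.e. $S$ is a finite set and $R\subseteq S\times S$. Its $K$-linearization $K(\Gamma)=[\mu_\Gamma,\nu_\Gamma:KR\to KS]$ has as its spaces the $K$-vector spaces with bases $R$ and $S$, with $\mu_\Gamma(x,y)=x$ and $\nu_\Gamma(x,y)=y$ for $(x,y)\in R$. For an equivalence relation $\sim$ on $S$, let $\Gamma/{\sim}$ be the binary relation on $S/{\sim}$ in which two classes $\alpha,\beta$ are related if $aRb$ for some $a\in\alpha$, $b\in\beta$. The left contraction $C_l\Gamma$ is $\Gamma/{\sim}$ for the smallest equivalence relation $\sim$ such that $xRy$ and $xRy'$ imply $y\sim y'$; the right contraction $C_r\Gamma$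 is $\Gamma/{\sim}$ for the smallest equivalence relation $\sim$ such that $xRy$ and $x'Ry$ imply $x\sim x'$. For $m,n\ge 0$ let $\gamma_{m,n}=\gamma_{m,n}(\Gamma)$ be the number of vertices of $C_l^mC_r^n\Gamma$. **Theorem.** For every $n\ge 1$, $$\begin{aligned} t^0_n(K(\Gamma))&=\gamma_{n+1,n-1}-\gamma_{n,n}-\gamma_{n+1,n}+\gamma_{n,n+1}=\gamma_{n-1,n+1}-\gamma_{n,n}-\gamma_{n-1,n}+\gamma_{n,n-1},\\ {}^0t_n(K(\Gamma))&=\gamma_{n-1,n+1}-\gamma_{n,n}-\gamma_{n,n+1}+\gamma_{n+1,n}=\gamma_{n+1,n-1}-\gamma_{n,n}-\gamma_{n,n-1}+\gamma_{n-1,n}. \end{aligned}$$ For every $p\ge 0$, $${}^0t^0_{2p+1}(K(\Gamma))=\gamma_{p,p}-\gamma_{p,p+1}-\gamma_{p+1,p}+\gamma_{p+1,p+1},$$ and for every $p\ge 1$, $${}^0t^0_{2p}(K(\Gamma))=\gamma_{p,p-1}-\gamma_{p,p}-\gamma_{p+1,p-1}+\gamma_{p+1,p}=\gamma_{p-1,p}-\gamma_{p,p}-\gamma_{p-1,p+1}+\gamma_{p,p+1}.$$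 -/

import Mathlib

universe u v w w'

namespace Kronecker

/-! ### Transformation-pairs -/

/-- A transformation-pair `[μ, ν : E → V]` over the field `K`: two linear maps between the same
two finite-dimensional `K`-vector spaces. -/
structure TsfPair (K : Type u) [Field K] where
  /-- the source space -/
  E : Type w
  /-- the target space -/
  V : Type w
  [addCommGroupE : AddCommGroup E]
  [moduleE : Module K E]
  [finiteE : Module.Finite K E]
  [addCommGroupV : AddCommGroup V]
  [moduleV : Module K V]
  [finiteV : Module.Finite K V]
  /-- the first map -/
  μ : E →ₗ[K] V
  /-- the second map -/
  ν : E →ₗ[K] V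

attribute [instance] TsfPair.addCommGroupE TsfPair.moduleE TsfPair.finiteE
  TsfPair.addCommGroupV TsfPair.moduleV TsfPair.finiteV

namespace TsfPair

variable {K : Type u} [Field K]

/-- Two transformation-pairs are isomorphic: there are linear isomorphisms `α : E ≃ E'` and
`β : V ≃ V'` with `μ' ∘ α = β ∘ μ` and `ν' ∘ α = β ∘ ν`. -/
def IsIsomorphic (X : TsfPair.{u, w} K) (Y : TsfPair.{u, w'} K) : Prop :=
  ∃ (α : X.E ≃ₗ[K] Y.E) (β : X.V ≃ₗ[K] Y.V),
    (∀ x : X.E, Y.μ (α x) = β (X.μ x)) ∧ (∀ x : X.E, Y.ν (α x) = β (X.ν x))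

/-- The zero object `[0, 0 : 0 → 0]`. -/
def IsZero (X : TsfPair.{u, w} K) : Prop :=
  Subsingleton X.E ∧ Subsingleton X.V

/-- The direct sum of two transformation-pairs. -/
def directSum (X Y : TsfPair.{u, w} K) : TsfPair.{u, w} K where
  E := X.E × Y.E
  V := X.V × Y.V
  μ := X.μ.prodMap Y.μ
  ν := X.ν.prodMap Y.ν

/-- The direct sum of a finite family of transformation-pairs. -/
def finiteDirectSum {k : ℕ} (X : Fin k → TsfPair.{u, w} K) : TsfPair.{u, w} K where
  E := ∀ i, (X i).E
  V := ∀ i, (X i).V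
  μ := LinearMap.piMap fun i => (X i).μ
  ν := LinearMap.piMap fun i => (X i).ν

/-- `X` is indecomposable: it is not zero and it is not isomorphic to the direct sum of two
non-zero objects. -/
def Indecomposable (X : TsfPair.{u, w} K) : Prop :=
  ¬ X.IsZero ∧
    ∀ A B : TsfPair.{u, w} K, ¬ A.IsZero → ¬ B.IsZero → ¬ X.IsIsomorphic (A.directSum B)

/-- The family `X` is a decomposition of `π` as a finite direct sum of indecomposables. -/
def IsDecomposition (π : TsfPair.{u, w} K) {k : ℕ} (X : Fin k → TsfPair.{u, w} K) : Prop :=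
  (∀ i, (X i).Indecomposable) ∧ π.IsIsomorphic (finiteDirectSum X)

/-- `[π : κ] = m`: the object `π` has a decomposition as a finite direct sum of indecomposables,
and in every such decomposition the number of summands isomorphic to `κ` is equal to `m`.
(The value `m` is taken in `ℤ`, so that it can be compared with alternating sums.) -/
def HasMultiplicity (π : TsfPair.{u, w} K) (κ : TsfPair.{u, w'} K) (m : ℤ) : Prop :=
  (∃ (k : ℕ) (X : Fin k → TsfPair.{u, w} K), π.IsDecomposition X) ∧
    ∀ (k : ℕ) (X : Fin k → TsfPair.{u, w} K), π.IsDecomposition X →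
      (Nat.card {i : Fin k // (X i).IsIsomorphic κ} : ℤ) = m

end TsfPair

/-! ### The indecomposable types `⁰Tₙ`, `Tₙ⁰`, `⁰Tₙ⁰` -/

section Types

variable (K : Type u) [Field K]

/-- The standard basis vector of `Kⁿ` with (zero-based) index `k`; it is `0` if `n ≤ k`. -/
def stdVec (n k : ℕ) : Fin n → K := fun j => if (j : ℕ) = k then 1 else 0

/-- The linear map `Kᵐ → Kⁿ` that takes the `i`-th standard basis vector to `g i`. -/
noncomputable def mapOfBasis {m n : ℕ} (g : Fin m → Fin n → K) : (Fin m → K) →ₗ[K] (Fin n → K) :=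
  (Pi.basisFun K (Fin m)).constr K g

/-- The nilpotent endomorphism `f₁ ↦ f₂ ↦ ⋯ ↦ fₙ ↦ 0` of `Kⁿ`. -/
noncomputable def nilp (n : ℕ) : (Fin n → K) →ₗ[K] (Fin n → K) :=
  mapOfBasis K fun i => stdVec K n (i + 1)

/-- The type `⁰Tₙ = [μₙ, Iₙ : Kⁿ → Kⁿ]`. -/
noncomputable def zeroT (n : ℕ) : TsfPair.{u, u} K where
  E := Fin n → K
  V := Fin n → K
  μ := nilp K n
  ν := LinearMap.id

/-- The type `Tₙ⁰ = [Iₙ, μₙ : Kⁿ → Kⁿ]`. -/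
noncomputable def TZero (n : ℕ) : TsfPair.{u, u} K where
  E := Fin n → K
  V := Fin n → K
  μ := LinearMap.id
  ν := nilp K n

/-- The type `⁰Tₙ⁰ = [κ'ₙ, λ'ₙ : Kⁿ⁺¹ → Kⁿ]`, where `κ'ₙ` maps `f₁ ↦ f₁, …, fₙ ↦ fₙ, fₙ₊₁ ↦ 0`
and `λ'ₙ` maps `f₁ ↦ 0, f₂ ↦ f₁, …, fₙ₊₁ ↦ fₙ`. -/
noncomputable def zeroTZero (n : ℕ) : TsfPair.{u, u} K where
  E := Fin (n + 1) → K
  V := Fin n → K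
  μ := mapOfBasis K fun i => stdVec K n i
  ν := mapOfBasis K fun i => if (i : ℕ) = 0 then 0 else stdVec K n (i - 1)

end Types

/-! ### Binary relations, their contractions and their linearization -/

/-- A binary relation `Γ = (R, S)`, that is, `R ⊆ S × S`; equivalently a reduced directed graph
with vertex set `S` and edge set `R`. -/
structure BinRel where
  /-- the set of vertices -/
  S : Type v
  /-- `R x y` means that `(x, y)` is an edge, with initial vertex `x` and terminal vertex `y` -/
  R : S → S → Prop

namespace BinRel

/-- The quotient `Γ/∼`: two classes are related if some representatives are. -/
def quotient (Γ : BinRel.{v}) (s : Setoid Γ.S) : BinRel.{v} where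
  S := Quotient s
  R := fun α β => ∃ a b : Γ.S, Quotient.mk s a = α ∧ Quotient.mk s b = β ∧ Γ.R a b

/-- The smallest equivalence relation such that `x R y` and `x R y'` imply `y ∼ y'`. -/
def leftSetoid (Γ : BinRel.{v}) : Setoid Γ.S :=
  Relation.EqvGen.setoid fun y y' => ∃ x, Γ.R x y ∧ Γ.R x y'

/-- The smallest equivalence relation such that `x R y` and `x' R y` imply `x ∼ x'`. -/
def rightSetoid (Γ : BinRel.{v}) : Setoid Γ.S :=
  Relation.EqvGen.setoid fun x x' => ∃ y, Γ.R x y ∧ Γ.R x' y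

/-- The left contraction `C_l Γ`. -/
def leftContraction (Γ : BinRel.{v}) : BinRel.{v} := Γ.quotient Γ.leftSetoid

/-- The right contraction `C_r Γ`. -/
def rightContraction (Γ : BinRel.{v}) : BinRel.{v} := Γ.quotient Γ.rightSetoid

/-- `γ_{m,n}(Γ)`: the number of vertices of `C_l^m C_r^n Γ`. -/
noncomputable def gamma (m n : ℕ) (Γ : BinRel.{v}) : ℤ :=
  Nat.card (leftContraction^[m] (rightContraction^[n] Γ)).S

/-- The `K`-linearization `[μ_Γ, ν_Γ : KR → KV]` of a finite binary relation, with
`μ_Γ (x, y) = x` and `ν_Γ (x, y) = y` on the basis of edges. -/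
noncomputable def linearization (K : Type u) [Field K] (Γ : BinRel.{v}) [Finite Γ.S] :
    TsfPair.{u, max u v} K where
  E := {e : Γ.S × Γ.S // Γ.R e.1 e.2} →₀ K
  V := Γ.S →₀ K
  μ := Finsupp.lmapDomain K K fun e => e.1.1
  ν := Finsupp.lmapDomain K K fun e => e.1.2

end BinRel

end Kronecker

open Kronecker Kronecker.BinRel

/-! Contractions are linear algebra in disguise. If S' is a quotient of S, then KS' is KS modulo the
kernel U of the induced map. A left contraction replaces U by U + ν(μ⁻¹U), a right contraction by U
+ μ(ν⁻¹U). Hence γ_{m,n} is the codimension `corank m n` of the subspace reached from 0 by n right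
and then m left steps (`gamma_eq_corank`). The corank makes sense for every transformation-pair, is
invariant under isomorphism and additive on direct sums, so it is enough to evaluate it on
indecomposables.

If both maps are injective, every step fixes 0 and the corank is dim V for all m, n. Any other
indecomposable is some T_N⁰, ⁰T_N or ⁰T_N⁰ (`Indecomposable.classification`), with coranks max(N -
n, 0), max(N - m, 0) and max(N - m - n, 0). Each alternating sum is a second difference of x ↦ max(N
- x, 0) in exactly one of the arguments n, m, m + n, hence 1 for a single N and 0 for the others; in
the other two arguments, and on constants, its terms cancel. So it counts the summands of one type
in any decomposition (`hasMultiplicity_of_corank`); Krull–Schmidt is not needed.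

The classification is an induction on dim E. Unless a smallest type splits off, X can be recovered
from the pair induced on E / ker ν and V / μ(ker ν) by the construction `extend`, and `extend` sends
each type to the next one. -/

namespace Kronecker

namespace TsfPair

variable {K : Type u} [Field K]

/-! ### Isomorphisms -/

theorem IsIsomorphic.symm {X : TsfPair.{u, w} K} {Y : TsfPair.{u, w'} K}
    (h : X.IsIsomorphic Y) : Y.IsIsomorphic X := by
  obtain ⟨α, β, hμ, hν⟩ := h
  exact ⟨α.symm, β.symm, fun x => β.injective (by simp [← hμ]),
    fun x => β.injective (by simp [← hν])⟩

theorem IsIsomorphic.trans {X : TsfPair.{u, w} K} {Y : TsfPair.{u, w'} K} {Z : TsfPair.{u, v} K}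
    (h : X.IsIsomorphic Y) (h' : Y.IsIsomorphic Z) : X.IsIsomorphic Z := by
  obtain ⟨α, β, hμ, hν⟩ := h
  obtain ⟨α', β', hμ', hν'⟩ := h'
  exact ⟨α.trans α', β.trans β', fun x => by simp [hμ, hμ'], fun x => by simp [hν, hν']⟩

theorem IsIsomorphic.isZero {X : TsfPair.{u, w} K} {Y : TsfPair.{u, w'} K}
    (h : X.IsIsomorphic Y) (hY : Y.IsZero) : X.IsZero := by
  obtain ⟨α, β, -, -⟩ := h
  obtain ⟨_, _⟩ := hY
  exact ⟨α.toEquiv.subsingleton, β.toEquiv.subsingleton⟩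

theorem IsIsomorphic.directSum {X X' Y Y' : TsfPair.{u, w} K} (h : X.IsIsomorphic X')
    (h' : Y.IsIsomorphic Y') : (X.directSum Y).IsIsomorphic (X'.directSum Y') := by
  obtain ⟨α, β, hμ, hν⟩ := h
  obtain ⟨α', β', hμ', hν'⟩ := h'
  exact ⟨α.prodCongr α', β.prodCongr β', fun x => Prod.ext (hμ x.1) (hμ' x.2),
    fun x => Prod.ext (hν x.1) (hν' x.2)⟩

theorem Indecomposable.of_isIsomorphic {X Y : TsfPair.{u, w} K} (hX : X.Indecomposable)
    (h : X.IsIsomorphic Y) : Y.Indecomposable :=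
  ⟨fun hY => hX.1 (h.isZero hY), fun A B hA hB hAB => hX.2 A B hA hB (h.trans hAB)⟩

/-- The transformation-pair with the two maps interchanged. -/
def swap (X : TsfPair.{u, w} K) : TsfPair.{u, w} K where
  E := X.E
  V := X.V
  μ := X.ν
  ν := X.μ

theorem IsIsomorphic.swap {X : TsfPair.{u, w} K} {Y : TsfPair.{u, w'} K}
    (h : X.IsIsomorphic Y) : X.swap.IsIsomorphic Y.swap := by
  obtain ⟨α, β, hμ, hν⟩ := h
  exact ⟨α, β, hν, hμ⟩

theorem Indecomposable.swap {X : TsfPair.{u, w} K} (hX : X.Indecomposable) :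
    X.swap.Indecomposable :=
  ⟨hX.1, fun A B hA hB hAB => hX.2 A.swap B.swap hA hB hAB.swap⟩

/-! ### Existence of decompositions -/

/-- The direct sum of a family of transformation-pairs indexed by a finite type. -/
def piSum {ι : Type} [Fintype ι] (X : ι → TsfPair.{u, w} K) : TsfPair.{u, w} K where
  E := ∀ i, (X i).E
  V := ∀ i, (X i).V
  μ := LinearMap.piMap fun i => (X i).μ
  ν := LinearMap.piMap fun i => (X i).ν

theorem piSum_sum_isIsomorphic {ι κ : Type} [Fintype ι] [Fintype κ]
    (X : ι → TsfPair.{u, w} K) (Y : κ → TsfPair.{u, w} K) :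
    ((piSum X).directSum (piSum Y)).IsIsomorphic (piSum (Sum.elim X Y)) :=
  IsIsomorphic.symm
    ⟨LinearEquiv.sumPiEquivProdPi K ι κ fun i => (Sum.elim X Y i).E,
      LinearEquiv.sumPiEquivProdPi K ι κ fun i => (Sum.elim X Y i).V, fun _ => rfl, fun _ => rfl⟩

theorem piSum_reindex_isIsomorphic {ι κ : Type} [Fintype ι] [Fintype κ]
    (X : ι → TsfPair.{u, w} K) (e : κ ≃ ι) :
    (piSum X).IsIsomorphic (piSum fun k => X (e k)) := by
  refine ⟨(LinearEquiv.piCongrLeft K (fun i => (X i).E) e).symm,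
    (LinearEquiv.piCongrLeft K (fun i => (X i).V) e).symm, fun _ => rfl, fun _ => rfl⟩

/-- Induction on dim E + dim V. Arbitrary finite index types allow two decompositions to be joined
over `ι ⊕ κ` without arithmetic in `Fin`. -/
theorem exists_piSum_isIsomorphic (d : ℕ) : ∀ X : TsfPair.{u, w} K,
    Module.finrank K X.E + Module.finrank K X.V = d →
    ∃ (ι : Type) (_ : Fintype ι) (Y : ι → TsfPair.{u, w} K),
      (∀ i, (Y i).Indecomposable) ∧ X.IsIsomorphic (piSum Y) := by
  induction d using Nat.strong_induction_on with
  | _ d ih =>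
    intro X hd
    by_cases hX : X.IsZero
    · obtain ⟨_, _⟩ := hX
      refine ⟨Empty, inferInstance, fun i => i.elim, fun i => i.elim, ?_⟩
      let Z : TsfPair.{u, w} K := piSum fun i : Empty => i.elim
      have : Subsingleton Z.E := inferInstanceAs (Subsingleton (∀ i : Empty, _))
      have : Subsingleton Z.V := inferInstanceAs (Subsingleton (∀ i : Empty, _))
      exact ⟨(0 : X.E ≃ₗ[K] Z.E), (0 : X.V ≃ₗ[K] Z.V), fun _ => Subsingleton.elim _ _,
        fun _ => Subsingleton.elim _ _⟩
    by_cases hi : X.Indecomposable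
    · refine ⟨Unit, inferInstance, fun _ => X, fun _ => hi, ?_⟩
      exact ⟨(LinearEquiv.funUnique Unit K X.E).symm, (LinearEquiv.funUnique Unit K X.V).symm,
        fun _ => rfl, fun _ => rfl⟩
    · obtain ⟨A, B, hA, hB, hAB⟩ :
          ∃ A B : TsfPair.{u, w} K, ¬ A.IsZero ∧ ¬ B.IsZero ∧ X.IsIsomorphic (A.directSum B) := by
        by_contra hcon
        push Not at hcon
        exact hi ⟨hX, hcon⟩
      have pos : ∀ C : TsfPair.{u, w} K, ¬ C.IsZero →
          0 < Module.finrank K C.E + Module.finrank K C.V := by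
        intro C hC
        by_contra h0
        exact hC ⟨Module.finrank_zero_iff (R := K).1 (by omega),
          Module.finrank_zero_iff (R := K).1 (by omega)⟩
      have hE : Module.finrank K X.E = Module.finrank K A.E + Module.finrank K B.E := by
        obtain ⟨α, -, -⟩ := hAB
        rw [α.finrank_eq]
        exact Module.finrank_prod
      have hV : Module.finrank K X.V = Module.finrank K A.V + Module.finrank K B.V := by
        obtain ⟨-, β, -⟩ := hAB
        rw [β.finrank_eq]
        exact Module.finrank_prod
      have hA' := pos A hA
      have hB' := pos B hB
      obtain ⟨ι, _, Y, hY, hAY⟩ := ih _ (by omega) A rfl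
      obtain ⟨κ, _, Z, hZ, hBZ⟩ := ih _ (by omega) B rfl
      refine ⟨ι ⊕ κ, inferInstance, Sum.elim Y Z, ?_, ?_⟩
      · rintro (i | i)
        exacts [hY i, hZ i]
      · exact hAB.trans ((hAY.directSum hBZ).trans (piSum_sum_isIsomorphic Y Z))

theorem exists_isDecomposition (X : TsfPair.{u, w} K) :
    ∃ (k : ℕ) (Y : Fin k → TsfPair.{u, w} K), X.IsDecomposition Y := by
  obtain ⟨ι, _, Y, hY, hXY⟩ := exists_piSum_isIsomorphic _ X rfl
  exact ⟨_, fun i => Y ((Fintype.equivFin ι).symm i), fun i => hY _,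
    hXY.trans (piSum_reindex_isIsomorphic Y (Fintype.equivFin ι).symm)⟩

/-! ### Contraction of subspaces -/

/-- The smallest subspace containing `U` and the `ν`-image of the `μ`-preimage of `U`. -/
def leftStep (X : TsfPair.{u, w} K) (U : Submodule K X.V) : Submodule K X.V :=
  U ⊔ (U.comap X.μ).map X.ν

/-- The smallest subspace containing `U` and the `μ`-image of the `ν`-preimage of `U`. -/
def rightStep (X : TsfPair.{u, w} K) (U : Submodule K X.V) : Submodule K X.V :=
  U ⊔ (U.comap X.ν).map X.μ

theorem mem_leftStep {X : TsfPair.{u, w} K} {U : Submodule K X.V} {x : X.V} :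
    x ∈ X.leftStep U ↔ ∃ y ∈ U, ∃ e, X.μ e ∈ U ∧ y + X.ν e = x := by
  simp [leftStep, Submodule.mem_sup]

/-- A right step is by definition a left step of the swapped pair; facts about right steps are
obtained in this way below. -/
theorem mem_rightStep {X : TsfPair.{u, w} K} {U : Submodule K X.V} {x : X.V} :
    x ∈ X.rightStep U ↔ ∃ y ∈ U, ∃ e, X.ν e ∈ U ∧ y + X.μ e = x :=
  mem_leftStep (X := X.swap)

theorem leftStep_map {X : TsfPair.{u, w} K} {Y : TsfPair.{u, w'} K}
    (α : X.E ≃ₗ[K] Y.E) (β : X.V ≃ₗ[K] Y.V) (hμ : ∀ x, Y.μ (α x) = β (X.μ x))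
    (hν : ∀ x, Y.ν (α x) = β (X.ν x)) (U : Submodule K X.V) :
    Y.leftStep (U.map (β : X.V →ₗ[K] Y.V)) = (X.leftStep U).map (β : X.V →ₗ[K] Y.V) := by
  ext y
  obtain ⟨x, rfl⟩ := β.surjective y
  have mem : ∀ (W : Submodule K X.V) x, β x ∈ W.map (β : X.V →ₗ[K] Y.V) ↔ x ∈ W := by
    intro W x
    simp
  rw [mem, mem_leftStep, mem_leftStep]
  constructor
  · rintro ⟨_, ⟨u, hu, rfl⟩, e, he, h⟩
    obtain ⟨e, rfl⟩ := α.surjective e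
    rw [hμ, mem] at he
    refine ⟨u, hu, e, he, β.injective ?_⟩
    rw [← h, map_add, hν]
    rfl
  · rintro ⟨u, hu, e, he, rfl⟩
    refine ⟨β u, (mem _ _).2 hu, α e, ?_, ?_⟩
    · rwa [hμ, mem]
    · rw [hν, map_add]

theorem leftStep_pi {k : ℕ} (X : Fin k → TsfPair.{u, w} K) (U : ∀ i, Submodule K (X i).V) :
    (finiteDirectSum X).leftStep (Submodule.pi Set.univ U) =
      Submodule.pi Set.univ fun i => (X i).leftStep (U i) := by
  ext x
  refine (mem_leftStep (X := finiteDirectSum X)).trans (Iff.trans ?_ Submodule.mem_pi.symm)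
  simp only [Set.mem_univ, true_imp_iff, mem_leftStep]
  constructor
  · rintro ⟨y, hy, e, he, rfl⟩ i
    exact ⟨y i, Submodule.mem_pi.1 hy i trivial, e i, Submodule.mem_pi.1 he i trivial, rfl⟩
  · intro h
    choose y hy e he h using h
    exact ⟨y, Submodule.mem_pi.2 fun i _ => hy i, e, Submodule.mem_pi.2 fun i _ => he i,
      funext h⟩

/-- The codimension of the subspace obtained from `0` by `n` right and then `m` left steps. -/
noncomputable def corank (m n : ℕ) (X : TsfPair.{u, w} K) : ℤ :=
  Module.finrank K (X.V ⧸ X.leftStep^[m] (X.rightStep^[n] ⊥))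

theorem IsIsomorphic.corank_eq {X : TsfPair.{u, w} K} {Y : TsfPair.{u, w'} K}
    (h : X.IsIsomorphic Y) (m n : ℕ) : corank m n X = corank m n Y := by
  obtain ⟨α, β, hμ, hν⟩ := h
  have hr : (X.rightStep^[n] ⊥).map (β : X.V →ₗ[K] Y.V) = Y.rightStep^[n] ⊥ := by
    induction n with
    | zero => simp
    | succ n ih =>
      rw [Function.iterate_succ_apply', Function.iterate_succ_apply', ← ih]
      exact (leftStep_map (X := X.swap) (Y := Y.swap) α β hν hμ _).symm
  have hl : (X.leftStep^[m] (X.rightStep^[n] ⊥)).map (β : X.V →ₗ[K] Y.V) =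
      Y.leftStep^[m] (Y.rightStep^[n] ⊥) := by
    induction m with
    | zero => exact hr
    | succ m ih =>
      rw [Function.iterate_succ_apply', Function.iterate_succ_apply', ← ih]
      exact (leftStep_map α β hμ hν _).symm
  exact congrArg Nat.cast (Submodule.Quotient.equiv _ _ β hl).finrank_eq

theorem corank_finiteDirectSum (m n : ℕ) {k : ℕ} (X : Fin k → TsfPair.{u, w} K) :
    corank m n (finiteDirectSum X) = ∑ i, corank m n (X i) := by
  have hr : (finiteDirectSum X).rightStep^[n] ⊥ =
      Submodule.pi Set.univ fun i => (X i).rightStep^[n] ⊥ := by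
    induction n with
    | zero => exact (Submodule.pi_univ_bot).symm
    | succ n ih =>
      simp only [Function.iterate_succ_apply']
      rw [ih]
      exact leftStep_pi (fun i => (X i).swap) _
  have hl : (finiteDirectSum X).leftStep^[m] ((finiteDirectSum X).rightStep^[n] ⊥) =
      Submodule.pi Set.univ fun i => (X i).leftStep^[m] ((X i).rightStep^[n] ⊥) := by
    induction m with
    | zero => exact hr
    | succ m ih =>
      simp only [Function.iterate_succ_apply']
      rw [ih]
      exact leftStep_pi X _
  unfold corank
  rw [hl, ← Nat.cast_sum, ← Module.finrank_pi_fintype]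
  exact congrArg Nat.cast (Submodule.quotientPi _).finrank_eq

/-- An alternating sum of four coranks that is `1` on `κ` and `0` on all other indecomposables
is the multiplicity of `κ`. -/
theorem hasMultiplicity_of_corank {κ : TsfPair.{u, w'} K} {a b c d : ℕ × ℕ}
    (hκ : corank a.1 a.2 κ - corank b.1 b.2 κ - corank c.1 c.2 κ + corank d.1 d.2 κ = 1)
    (h : ∀ X : TsfPair.{u, w} K, X.Indecomposable → ¬ X.IsIsomorphic κ →
      corank a.1 a.2 X - corank b.1 b.2 X - corank c.1 c.2 X + corank d.1 d.2 X = 0)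
    (π : TsfPair.{u, w} K) :
    π.HasMultiplicity κ
      (corank a.1 a.2 π - corank b.1 b.2 π - corank c.1 c.2 π + corank d.1 d.2 π) := by
  classical
  refine ⟨exists_isDecomposition π, fun k X hX => ?_⟩
  -- The decomposition is arbitrary: each of its summands contributes 1 or 0, so all decompositions
  -- give the same count.
  simp only [hX.2.corank_eq, corank_finiteDirectSum]
  rw [← Finset.sum_sub_distrib, ← Finset.sum_sub_distrib, ← Finset.sum_add_distrib,
    Nat.card_eq_fintype_card, Fintype.card_subtype, Finset.card_filter, Nat.cast_sum]
  refine Finset.sum_congr rfl fun i _ => ?_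
  split_ifs with hi
  · simp only [hi.corank_eq, hκ, Nat.cast_one]
  · rw [h _ (hX.1 i) hi, Nat.cast_zero]

end TsfPair

/-! ### Contractions of binary relations -/

namespace BinRel

variable {K : Type u} [Field K]

theorem lmapDomain_single_sub_single {S T : Type*} (f : S → T) (a b : S) :
    Finsupp.lmapDomain K K f (Finsupp.single a 1 - Finsupp.single b 1) =
      Finsupp.single (f a) 1 - Finsupp.single (f b) 1 := by
  rw [map_sub]
  simp

/-- With q a section of f over its image, every y differs from its image under q ∘ f by a
combination of the differences s - q(f s); for y in the kernel that image is 0. -/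
theorem ker_lmapDomain {S T : Type*} (f : S → T) :
    LinearMap.ker (Finsupp.lmapDomain K K f) =
      Submodule.span K {x | ∃ a b, f a = f b ∧ x = Finsupp.single a 1 - Finsupp.single b 1} := by
  apply le_antisymm
  · intro x hx
    let U := Submodule.span K
      {x : S →₀ K | ∃ a b, f a = f b ∧ x = Finsupp.single a 1 - Finsupp.single b 1}
    by_cases hS : Nonempty S
    · let q : T → S := Function.invFun f
      have hq : ∀ s, f (q (f s)) = f s := fun s => Function.invFun_eq ⟨s, rfl⟩
      have key : ∀ y : S →₀ K, y - Finsupp.lmapDomain K K q (Finsupp.lmapDomain K K f y) ∈ U := by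
        intro y
        induction y using Finsupp.induction_linear with
        | zero => simp
        | add y z hy hz =>
          rw [map_add, map_add, add_sub_add_comm]
          exact U.add_mem hy hz
        | single s c =>
          have : Finsupp.single s c - Finsupp.lmapDomain K K q
              (Finsupp.lmapDomain K K f (Finsupp.single s c)) =
              c • (Finsupp.single s 1 - Finsupp.single (q (f s)) 1) := by
            simp [smul_sub]
          rw [this]
          exact U.smul_mem _ (Submodule.subset_span ⟨_, _, (hq s).symm, rfl⟩)
      have := key x
      rwa [LinearMap.mem_ker.1 hx, map_zero, sub_zero] at this
    · have := not_nonempty_iff.1 hS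
      rw [Subsingleton.elim x 0]
      exact zero_mem _
  · rw [Submodule.span_le]
    rintro _ ⟨a, b, h, rfl⟩
    rw [SetLike.mem_coe, LinearMap.mem_ker, lmapDomain_single_sub_single, h, sub_self]

/-- `Γ'` is the quotient of `Γ` by a surjection on the vertices whose linearization has
kernel `U`. -/
def IsQuotientBy (Γ Γ' : BinRel.{v}) (U : Submodule K (Γ.S →₀ K)) : Prop :=
  ∃ q : Γ.S → Γ'.S, Function.Surjective q ∧
    (∀ x y, Γ'.R x y ↔ ∃ a b, q a = x ∧ q b = y ∧ Γ.R a b) ∧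
    LinearMap.ker (Finsupp.lmapDomain K K q) = U

theorem IsQuotientBy.finrank_eq {Γ Γ' : BinRel.{v}} [Finite Γ.S] {U : Submodule K (Γ.S →₀ K)}
    (h : IsQuotientBy Γ Γ' U) : Module.finrank K ((Γ.S →₀ K) ⧸ U) = Nat.card Γ'.S := by
  obtain ⟨q, hq, -, rfl⟩ := h
  have : Finite Γ'.S := Finite.of_surjective q hq
  have := Fintype.ofFinite Γ'.S
  rw [(LinearMap.quotKerEquivOfSurjective (Finsupp.lmapDomain K K q)
    (Finsupp.mapDomain_surjective hq)).finrank_eq, Module.finrank_finsupp_self,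
    Nat.card_eq_fintype_card]

/-- Dividing out the equivalence relation generated by the relation "the edges with vertices
`a, b` at one end have the same vertex at the other end". -/
theorem ker_quotient_eq {S T D : Type*} (q : S → T) (hq : Function.Surjective q) (f g : D → S) :
    LinearMap.ker (Finsupp.lmapDomain K K fun s => Quotient.mk (Relation.EqvGen.setoid
        fun y y' => ∃ x, (∃ e, q (f e) = x ∧ q (g e) = y) ∧ ∃ e, q (f e) = x ∧ q (g e) = y') (q s)) =
      LinearMap.ker (Finsupp.lmapDomain K K q) ⊔
        ((LinearMap.ker (Finsupp.lmapDomain K K q)).comap (Finsupp.lmapDomain K K f)).map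
          (Finsupp.lmapDomain K K g) := by
  set r : T → T → Prop :=
    fun y y' => ∃ x, (∃ e, q (f e) = x ∧ q (g e) = y) ∧ ∃ e, q (f e) = x ∧ q (g e) = y'
  set U := LinearMap.ker (Finsupp.lmapDomain K K q)
  have memU : ∀ a b, q a = q b → Finsupp.single a (1 : K) - Finsupp.single b 1 ∈ U := by
    intro a b h
    rw [LinearMap.mem_ker, lmapDomain_single_sub_single, h, sub_self]
  apply le_antisymm
  · rw [ker_lmapDomain, Submodule.span_le]
    rintro _ ⟨a, b, hab, rfl⟩
    -- Quantifying over all lifts a, b lets the transitivity case choose any lift of the middle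
    -- point.
    have main : ∀ x y, Relation.EqvGen r x y → ∀ a b, q a = x → q b = y →
        Finsupp.single a (1 : K) - Finsupp.single b 1 ∈
          U ⊔ (U.comap (Finsupp.lmapDomain K K f)).map (Finsupp.lmapDomain K K g) := by
      intro x y h
      induction h with
      | rel x y h =>
        rintro a b rfl rfl
        obtain ⟨z, ⟨e, he, hea⟩, e', he', heb⟩ := h
        have h1 : Finsupp.single (g e) (1 : K) - Finsupp.single (g e') 1 ∈
            (U.comap (Finsupp.lmapDomain K K f)).map (Finsupp.lmapDomain K K g) := by
          refine ⟨Finsupp.single e 1 - Finsupp.single e' 1, ?_,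
            lmapDomain_single_sub_single _ _ _⟩
          rw [SetLike.mem_coe, Submodule.mem_comap, lmapDomain_single_sub_single]
          exact memU (f e) (f e') (he.trans he'.symm)
        have h2 := memU a (g e) hea.symm
        have h3 := memU (g e') b heb
        have : Finsupp.single a (1 : K) - Finsupp.single b 1 =
            ((Finsupp.single a 1 - Finsupp.single (g e) 1) +
              (Finsupp.single (g e') 1 - Finsupp.single b 1)) +
              (Finsupp.single (g e) 1 - Finsupp.single (g e') 1) := by abel
        rw [this]
        exact add_mem (Submodule.mem_sup_left (add_mem h2 h3)) (Submodule.mem_sup_right h1)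
      | refl x =>
        rintro a b rfl h
        exact Submodule.mem_sup_left (memU a b h.symm)
      | symm x y _ ih =>
        intro a b ha hb
        rw [← neg_sub]
        exact neg_mem (ih b a hb ha)
      | trans x y z _ _ ih ih' =>
        intro a b ha hb
        obtain ⟨c, hc⟩ := hq y
        rw [← sub_add_sub_cancel _ (Finsupp.single c 1)]
        exact add_mem (ih a c ha hc) (ih' c b hc hb)
    exact main _ _ (Quotient.exact hab) a b rfl rfl
  · refine sup_le ?_ ?_
    · rw [show U = _ from ker_lmapDomain q, Submodule.span_le]
      rintro _ ⟨a, b, h, rfl⟩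
      rw [SetLike.mem_coe, LinearMap.mem_ker, lmapDomain_single_sub_single, h, sub_self]
    · rw [Submodule.map_le_iff_le_comap]
      intro e he
      -- The kernel of the map induced by q ∘ f is spanned by differences of edges whose f-ends
      -- agree in T, and the g-ends of two such edges are related by r.
      have he' : e ∈ LinearMap.ker (Finsupp.lmapDomain K K fun d => q (f d)) := by
        rw [LinearMap.mem_ker]
        rw [Submodule.mem_comap, LinearMap.mem_ker] at he
        rw [← he]
        exact Finsupp.mapDomain_comp
      rw [ker_lmapDomain] at he'
      refine (Submodule.span_le.2 ?_ : _ ≤ Submodule.comap _ _) he'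
      rintro _ ⟨d, d', h, rfl⟩
      have : r (q (g d)) (q (g d')) := ⟨_, ⟨d, rfl, rfl⟩, d', h.symm, rfl⟩
      have h2 := Quotient.sound (s := Relation.EqvGen.setoid r) (Relation.EqvGen.rel _ _ this)
      rw [SetLike.mem_coe, Submodule.mem_comap, LinearMap.mem_ker, lmapDomain_single_sub_single,
        lmapDomain_single_sub_single, h2, sub_self]

theorem quotient_iff {Γ Γ' : BinRel.{v}} {q : Γ.S → Γ'.S}
    (hR : ∀ x y, Γ'.R x y ↔ ∃ a b, q a = x ∧ q b = y ∧ Γ.R a b) (s : Setoid Γ'.S)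
    (x y : Quotient s) : (Γ'.quotient s).R x y ↔
      ∃ a b, Quotient.mk s (q a) = x ∧ Quotient.mk s (q b) = y ∧ Γ.R a b := by
  constructor
  · rintro ⟨c, d, rfl, rfl, h⟩
    obtain ⟨a, b, rfl, rfl, h'⟩ := (hR c d).1 h
    exact ⟨a, b, rfl, rfl, h'⟩
  · rintro ⟨a, b, rfl, rfl, h⟩
    exact ⟨q a, q b, rfl, rfl, (hR _ _).2 ⟨a, b, rfl, rfl, h⟩⟩

theorem IsQuotientBy.leftContraction {Γ Γ' : BinRel.{v}} [Finite Γ.S]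
    {U : Submodule K (Γ.S →₀ K)} (h : IsQuotientBy Γ Γ' U) :
    IsQuotientBy Γ Γ'.leftContraction ((linearization K Γ).leftStep U) := by
  obtain ⟨q, hq, hR, rfl⟩ := h
  refine ⟨fun s => Quotient.mk _ (q s), Quotient.mk_surjective.comp hq, quotient_iff hR _, ?_⟩
  refine Eq.trans ?_ (ker_quotient_eq q hq
    (fun e : {e : Γ.S × Γ.S // Γ.R e.1 e.2} => e.1.1) fun e => e.1.2)
  -- Every edge of Γ' lifts to an edge of Γ, so the generating relation can be written with edges of
  -- Γ.
  have : (fun y y' => ∃ x, Γ'.R x y ∧ Γ'.R x y') = fun y y' => ∃ x,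
      (∃ e : {e : Γ.S × Γ.S // Γ.R e.1 e.2}, q e.1.1 = x ∧ q e.1.2 = y) ∧
      ∃ e : {e : Γ.S × Γ.S // Γ.R e.1 e.2}, q e.1.1 = x ∧ q e.1.2 = y' := by
    simp only [hR, Subtype.exists, Prod.exists]
    ext
    simp only [exists_prop]
    aesop
  rw [← this]
  rfl

theorem IsQuotientBy.rightContraction {Γ Γ' : BinRel.{v}} [Finite Γ.S]
    {U : Submodule K (Γ.S →₀ K)} (h : IsQuotientBy Γ Γ' U) :
    IsQuotientBy Γ Γ'.rightContraction ((linearization K Γ).rightStep U) := by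
  obtain ⟨q, hq, hR, rfl⟩ := h
  refine ⟨fun s => Quotient.mk _ (q s), Quotient.mk_surjective.comp hq, quotient_iff hR _, ?_⟩
  refine Eq.trans ?_ (ker_quotient_eq q hq
    (fun e : {e : Γ.S × Γ.S // Γ.R e.1 e.2} => e.1.2) fun e => e.1.1)
  have : (fun x x' => ∃ y, Γ'.R x y ∧ Γ'.R x' y) = fun y y' => ∃ x,
      (∃ e : {e : Γ.S × Γ.S // Γ.R e.1 e.2}, q e.1.2 = x ∧ q e.1.1 = y) ∧
      ∃ e : {e : Γ.S × Γ.S // Γ.R e.1 e.2}, q e.1.2 = x ∧ q e.1.1 = y' := by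
    simp only [hR, Subtype.exists, Prod.exists]
    ext
    simp only [exists_prop]
    aesop
  rw [← this]
  rfl

theorem gamma_eq_corank (m n : ℕ) (Γ : BinRel.{v}) [Finite Γ.S] :
    gamma m n Γ = TsfPair.corank m n (linearization K Γ) := by
  have h0 : IsQuotientBy Γ Γ (⊥ : Submodule K (Γ.S →₀ K)) := by
    refine ⟨id, Function.surjective_id, fun x y => by simp, ?_⟩
    rw [Finsupp.lmapDomain_id]
    exact LinearMap.ker_id
  have hr : IsQuotientBy Γ (BinRel.rightContraction^[n] Γ)
      ((linearization K Γ).rightStep^[n] ⊥) := by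
    induction n with
    | zero => exact h0
    | succ n ih =>
      rw [Function.iterate_succ_apply', Function.iterate_succ_apply']
      exact ih.rightContraction
  have hl : IsQuotientBy Γ (BinRel.leftContraction^[m] (BinRel.rightContraction^[n] Γ))
      ((linearization K Γ).leftStep^[m] ((linearization K Γ).rightStep^[n] ⊥)) := by
    induction m with
    | zero => exact hr
    | succ m ih =>
      rw [Function.iterate_succ_apply', Function.iterate_succ_apply']
      exact ih.leftContraction
  exact congrArg Nat.cast hl.finrank_eq.symm

end BinRel

end Kronecker

namespace Kronecker

section Types

variable (K : Type u) [Field K]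

/-! ### Coordinate formulas for the maps of the types. -/

theorem mapOfBasis_apply {m n : ℕ} (g : Fin m → Fin n → K) (x : Fin m → K) (j : Fin n) :
    mapOfBasis K g x j = ∑ i, x i * g i j := by
  simp [mapOfBasis, Module.Basis.constr_apply_fintype]

theorem nilp_apply_zero (n : ℕ) (x : Fin (n + 1) → K) : nilp K (n + 1) x 0 = 0 := by
  simp [nilp, mapOfBasis_apply, stdVec]

theorem nilp_apply_succ (n : ℕ) (x : Fin (n + 1) → K) (j : Fin n) :
    nilp K (n + 1) x j.succ = x j.castSucc := by
  rw [nilp, mapOfBasis_apply, Finset.sum_eq_single j.castSucc]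
  · simp [stdVec]
  · intro i _ hi
    have : (j : ℕ) ≠ i := fun h => hi (Fin.ext h.symm)
    simp [stdVec, this]
  · simp

theorem zeroTZero_μ_apply (n : ℕ) (x : Fin (n + 1) → K) :
    (zeroTZero K n).μ x = fun j : Fin n => x j.castSucc := by
  funext j
  refine (mapOfBasis_apply K _ _ _).trans ?_
  rw [Finset.sum_eq_single j.castSucc]
  · simp [stdVec]
  · intro i _ hi
    have : (j : ℕ) ≠ i := fun h => hi (Fin.ext h.symm)
    simp [stdVec, this]
  · simp

theorem zeroTZero_ν_apply (n : ℕ) (x : Fin (n + 1) → K) :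
    (zeroTZero K n).ν x = fun j : Fin n => x j.succ := by
  funext j
  refine (mapOfBasis_apply K _ _ _).trans ?_
  rw [Finset.sum_eq_single j.succ]
  · simp [stdVec]
  · intro i _ hi
    refine Fin.cases ?_ (fun i hi => ?_) i hi
    · simp
    · have : (j : ℕ) ≠ i := fun h => hi (by rw [Fin.ext h])
      simp [stdVec, this]
  · simp

/-! ### Coranks of the types -/

/-- The vectors in `Kⁿ` whose coordinates vanish except for the first `a` and the last `b`. -/
def outerSubspace (n a b : ℕ) : Submodule K (Fin n → K) where
  carrier := {x | ∀ j : Fin n, a ≤ j → j + b < n → x j = 0}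
  zero_mem' := by simp
  add_mem' := by
    intro x y hx hy j h h'
    simp [hx j h h', hy j h h']
  smul_mem' := by
    intro c x hx j h h'
    simp [hx j h h']

variable {K} in
theorem mem_outerSubspace {n a b : ℕ} {x : Fin n → K} :
    x ∈ outerSubspace K n a b ↔ ∀ j : Fin n, a ≤ j → j + b < n → x j = 0 := Iff.rfl

theorem outerSubspace_zero_zero (n : ℕ) : outerSubspace K n 0 0 = ⊥ := by
  ext x
  simp [mem_outerSubspace, funext_iff]

/-- The middle coordinates a, …, n - b - 1 give the quotient. Truncated subtraction is correct even
when a + b ≥ n, where the subspace is everything. -/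
theorem finrank_quotient_outerSubspace (n a b : ℕ) :
    Module.finrank K ((Fin n → K) ⧸ outerSubspace K n a b) = n - a - b := by
  let f : (Fin n → K) →ₗ[K] (Fin (n - a - b) → K) :=
    LinearMap.funLeft K K fun j : Fin (n - a - b) => (⟨a + j, by omega⟩ : Fin n)
  have hf : Function.Surjective f :=
    LinearMap.funLeft_surjective_of_injective _ _ _ fun i j h => by
      have := congrArg Fin.val h
      exact Fin.ext (by simpa using this)
  have hker : LinearMap.ker f = outerSubspace K n a b := by
    ext x
    rw [LinearMap.mem_ker, mem_outerSubspace]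
    constructor
    · intro h j h1 h2
      have := congrFun h ⟨j - a, by omega⟩
      have hj : (⟨a + (j - a), by omega⟩ : Fin n) = j := Fin.ext (by simp; omega)
      simpa [f, LinearMap.funLeft_apply, hj] using this
    · intro h
      funext j
      exact h _ (by simp) (by simp; omega)
  rw [← hker, (f.quotKerEquivOfSurjective hf).finrank_eq, Module.finrank_fin_fun]

open TsfPair


/-- For ⁰Tₙ⁰, ν deletes the first coordinate and μ the last, so a right step moves support one place
to the right. Right steps come first, so no final coordinates need to be allowed here. -/
theorem step_castSucc_succ (n a : ℕ) (x : Fin n → K) :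
    (∃ y ∈ outerSubspace K n a 0, ∃ e : Fin (n + 1) → K,
      (fun j : Fin n => e j.succ) ∈ outerSubspace K n a 0 ∧
        (y + fun j : Fin n => e j.castSucc) = x) ↔ x ∈ outerSubspace K n (a + 1) 0 := by
  constructor
  · rintro ⟨y, hy, e, he, rfl⟩ j h1 h2
    obtain ⟨i, hi⟩ : ∃ i : Fin n, i.succ = j.castSucc :=
      ⟨⟨j - 1, by omega⟩, Fin.ext (by simp; omega)⟩
    have hi' := congrArg Fin.val hi
    simp only [Fin.val_succ, Fin.val_castSucc] at hi'
    have h3 := hy j (by omega) h2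
    have h4 : e i.succ = 0 := he i (by omega) (by omega)
    rw [Pi.add_apply, h3, ← hi, h4, zero_add]
  · intro hx
    let y : Fin n → K := fun j => if (j : ℕ) < a + 1 then x j else 0
    refine ⟨x - y, ?_, Fin.snoc y 0, ?_, ?_⟩
    · intro j h1 h2
      by_cases h : (j : ℕ) < a + 1
      · rw [Pi.sub_apply, show y j = x j from if_pos h, sub_self]
      · rw [Pi.sub_apply, show y j = 0 from if_neg h, sub_zero, hx j (by omega) h2]
    · intro j h1 h2
      refine Fin.lastCases ?_ (fun i hi => ?_) j.succ (motive := fun i => i = j.succ →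
        (Fin.snoc y 0 : Fin (n + 1) → K) i = 0) rfl
      · simp
      · have := congrArg Fin.val hi
        simp only [Fin.val_succ, Fin.val_castSucc] at this
        simp only [Fin.snoc_castSucc, y]
        rw [if_neg (by omega)]
    · simp only [Fin.snoc_castSucc]
      exact sub_add_cancel x y

theorem step_succ_castSucc (n a b : ℕ) (x : Fin n → K) :
    (∃ y ∈ outerSubspace K n a b, ∃ e : Fin (n + 1) → K,
      (fun j : Fin n => e j.castSucc) ∈ outerSubspace K n a b ∧
        (y + fun j : Fin n => e j.succ) = x) ↔ x ∈ outerSubspace K n a (b + 1) := by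
  constructor
  · rintro ⟨y, hy, e, he, rfl⟩ j h1 h2
    obtain ⟨i, hi⟩ : ∃ i : Fin n, i.castSucc = j.succ :=
      ⟨⟨j + 1, by omega⟩, Fin.ext (by simp)⟩
    have hi' := congrArg Fin.val hi
    simp only [Fin.val_succ, Fin.val_castSucc] at hi'
    have h3 := hy j (by omega) (by omega)
    have h4 : e i.castSucc = 0 := he i (by omega) (by omega)
    rw [Pi.add_apply, h3, ← hi, h4, zero_add]
  · intro hx
    -- The last b + 1 coordinates of x; the rest of x is supported on the first a. Prefixing a 0 and
    -- deleting the last entry leaves support on the last b.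
    let y : Fin n → K := fun j => if n < j + b + 2 then x j else 0
    refine ⟨x - y, ?_, Fin.cons 0 y, ?_, ?_⟩
    · intro j h1 h2
      by_cases h : n < j + b + 2
      · rw [Pi.sub_apply, show y j = x j from if_pos h, sub_self]
      · rw [Pi.sub_apply, show y j = 0 from if_neg h, sub_zero, hx j (by omega) (by omega)]
    · intro j h1 h2
      refine Fin.cases ?_ (fun i hi => ?_) j.castSucc (motive := fun i => i = j.castSucc →
        (Fin.cons 0 y : Fin (n + 1) → K) i = 0) rfl
      · simp
      · have := congrArg Fin.val hi
        simp only [Fin.val_succ, Fin.val_castSucc] at this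
        simp only [Fin.cons_succ, y]
        rw [if_neg (by omega)]
    · simp only [Fin.cons_succ]
      exact sub_add_cancel x y

theorem rightStep_zeroTZero (n a : ℕ) :
    (zeroTZero K n).rightStep (outerSubspace K n a 0) = outerSubspace K n (a + 1) 0 := by
  ext x
  refine mem_rightStep.trans (Iff.trans ?_ (step_castSucc_succ K n a x))
  refine exists_congr fun (y : Fin n → K) => and_congr_right fun _ => exists_congr fun e => ?_
  exact iff_of_eq (congrArg₂ And (congrArg (· ∈ outerSubspace K n a 0) (zeroTZero_ν_apply K n e))
    (congrArg (fun z : Fin n → K => y + z = x) (zeroTZero_μ_apply K n e)))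

theorem leftStep_zeroTZero (n a b : ℕ) :
    (zeroTZero K n).leftStep (outerSubspace K n a b) = outerSubspace K n a (b + 1) := by
  ext x
  refine mem_leftStep.trans (Iff.trans ?_ (step_succ_castSucc K n a b x))
  refine exists_congr fun (y : Fin n → K) => and_congr_right fun _ => exists_congr fun e => ?_
  exact iff_of_eq (congrArg₂ And (congrArg (· ∈ outerSubspace K n a b) (zeroTZero_μ_apply K n e))
    (congrArg (fun z : Fin n → K => y + z = x) (zeroTZero_ν_apply K n e)))

theorem corank_zeroTZero (N m n : ℕ) : corank m n (zeroTZero K N) = (N - n - m : ℕ) := by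
  have hr : (zeroTZero K N).rightStep^[n] ⊥ = outerSubspace K N n 0 := by
    induction n with
    | zero => exact (outerSubspace_zero_zero K N).symm
    | succ n ih => rw [Function.iterate_succ_apply', ih, rightStep_zeroTZero]
  have hl : (zeroTZero K N).leftStep^[m] ((zeroTZero K N).rightStep^[n] ⊥) =
      outerSubspace K N n m := by
    induction m with
    | zero => exact hr
    | succ m ih => rw [Function.iterate_succ_apply', ih, leftStep_zeroTZero]
  unfold corank
  rw [hl]
  exact congrArg Nat.cast (finrank_quotient_outerSubspace K N n m)

/-- The nilpotent map shifts coordinates one place to the right and drops the last one. -/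
theorem nilp_mem_outerSubspace {N b : ℕ} {x : Fin (N + 1) → K} :
    nilp K (N + 1) x ∈ outerSubspace K (N + 1) 0 b ↔ x ∈ outerSubspace K (N + 1) 0 (b + 1) := by
  constructor
  · intro h j _ hj
    have := h (⟨j, by omega⟩ : Fin N).succ (Nat.zero_le _) (by simp; omega)
    rwa [nilp_apply_succ] at this
  · intro h j
    refine Fin.cases ?_ (fun j => ?_) j
    · exact fun _ _ => nilp_apply_zero K N x
    · intro _ hj
      rw [nilp_apply_succ]
      exact h _ (Nat.zero_le _) (by simp at hj ⊢; omega)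

theorem outerSubspace_mono {n a b c : ℕ} (h : b ≤ c) :
    outerSubspace K n a b ≤ outerSubspace K n a c :=
  fun _ hx j h1 h2 => hx j h1 (by omega)

theorem step_nilp_preimage (N b : ℕ) (x : Fin (N + 1) → K) :
    (∃ y ∈ outerSubspace K (N + 1) 0 b, ∃ e, nilp K (N + 1) e ∈ outerSubspace K (N + 1) 0 b ∧
      y + e = x) ↔ x ∈ outerSubspace K (N + 1) 0 (b + 1) := by
  constructor
  · rintro ⟨y, hy, e, he, rfl⟩
    exact add_mem (outerSubspace_mono K (Nat.le_succ b) hy) ((nilp_mem_outerSubspace K).1 he)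
  · intro hx
    exact ⟨0, zero_mem _, x, (nilp_mem_outerSubspace K).2 hx, zero_add _⟩

theorem step_nilp_image (N b : ℕ) (x : Fin (N + 1) → K) :
    (∃ y ∈ outerSubspace K (N + 1) 0 b, ∃ e ∈ outerSubspace K (N + 1) 0 b,
      y + nilp K (N + 1) e = x) ↔ x ∈ outerSubspace K (N + 1) 0 b := by
  constructor
  · rintro ⟨y, hy, e, he, rfl⟩
    exact add_mem hy ((nilp_mem_outerSubspace K).2 (outerSubspace_mono K (Nat.le_succ b) he))
  · intro hx
    exact ⟨x, hx, 0, zero_mem _, by simp⟩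

/-- As μ is the identity, a right step adds the preimage under the nilpotent ν, which is one more
coordinate, while a left step adds an image under ν, which is already inside. -/
theorem corank_TZero (N m n : ℕ) : corank m n (TZero K (N + 1)) = (N + 1 - n : ℕ) := by
  have hr : (TZero K (N + 1)).rightStep^[n] ⊥ = outerSubspace K (N + 1) 0 n := by
    induction n with
    | zero => exact (outerSubspace_zero_zero K _).symm
    | succ n ih =>
      rw [Function.iterate_succ_apply', ih]
      ext x
      exact mem_rightStep.trans (step_nilp_preimage K N n x)
  have hl : (TZero K (N + 1)).leftStep^[m] ((TZero K (N + 1)).rightStep^[n] ⊥) =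
      outerSubspace K (N + 1) 0 n := by
    induction m with
    | zero => exact hr
    | succ m ih =>
      rw [Function.iterate_succ_apply', ih]
      ext x
      exact mem_leftStep.trans (step_nilp_image K N n x)
  unfold corank
  rw [hl]
  exact congrArg Nat.cast (finrank_quotient_outerSubspace K (N + 1) 0 n)

theorem corank_zeroT (N m n : ℕ) : corank m n (zeroT K (N + 1)) = (N + 1 - m : ℕ) := by
  have hr : (zeroT K (N + 1)).rightStep^[n] ⊥ = outerSubspace K (N + 1) 0 0 := by
    induction n with
    | zero => exact (outerSubspace_zero_zero K _).symm
    | succ n ih =>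
      rw [Function.iterate_succ_apply', ih]
      ext x
      exact mem_rightStep.trans (step_nilp_image K N 0 x)
  have hl : (zeroT K (N + 1)).leftStep^[m] ((zeroT K (N + 1)).rightStep^[n] ⊥) =
      outerSubspace K (N + 1) 0 m := by
    induction m with
    | zero => exact hr
    | succ m ih =>
      rw [Function.iterate_succ_apply', ih]
      ext x
      exact mem_leftStep.trans (step_nilp_preimage K N m x)
  unfold corank
  rw [hl]
  exact congrArg Nat.cast (finrank_quotient_outerSubspace K (N + 1) 0 m)

end Types

theorem TsfPair.corank_eq_of_injective {K : Type u} [Field K] {X : TsfPair.{u, w} K}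
    (hμ : LinearMap.ker X.μ = ⊥) (hν : LinearMap.ker X.ν = ⊥) (m n : ℕ) :
    corank m n X = corank 0 0 X := by
  have hr : X.rightStep^[n] ⊥ = ⊥ := by
    refine Function.iterate_fixed ?_ n
    rw [rightStep, Submodule.comap_bot, hν, Submodule.map_bot, sup_bot_eq]
  have hl : X.leftStep^[m] ⊥ = ⊥ := by
    refine Function.iterate_fixed ?_ m
    rw [leftStep, Submodule.comap_bot, hμ, Submodule.map_bot, sup_bot_eq]
  unfold corank
  rw [hr, hl]
  rfl

end Kronecker

namespace Kronecker

namespace TsfPair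

variable {K : Type u} [Field K]

/-! ### Indecomposables with a non-injective map -/

/-- The restriction of a transformation-pair to a pair of subspaces. -/
def restrict (X : TsfPair.{u, w} K) (P : Submodule K X.E) (Q : Submodule K X.V)
    (hμ : P ≤ Q.comap X.μ) (hν : P ≤ Q.comap X.ν) : TsfPair.{u, w} K where
  E := P
  V := Q
  μ := X.μ.restrict hμ
  ν := X.ν.restrict hν

/-- The internal form of indecomposability, used to split off a summand generated by one vector. -/
theorem Indecomposable.eq_bot_of_isCompl {X : TsfPair.{u, w} K} (hX : X.Indecomposable)
    {P P' : Submodule K X.E} {Q Q' : Submodule K X.V} (hP : IsCompl P P') (hQ : IsCompl Q Q')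
    (hμ : P ≤ Q.comap X.μ) (hν : P ≤ Q.comap X.ν) (hμ' : P' ≤ Q'.comap X.μ)
    (hν' : P' ≤ Q'.comap X.ν) (h : P ≠ ⊥) : P' = ⊥ ∧ Q' = ⊥ := by
  by_contra hcon
  refine hX.2 (X.restrict P Q hμ hν) (X.restrict P' Q' hμ' hν') ?_ ?_ (IsIsomorphic.symm
    ⟨Submodule.prodEquivOfIsCompl P P' hP, Submodule.prodEquivOfIsCompl Q Q' hQ, ?_, ?_⟩)
  · rintro ⟨h', -⟩
    exact h (Submodule.subsingleton_iff_eq_bot.1 h')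
  · rintro ⟨h1, h2⟩
    exact hcon ⟨Submodule.subsingleton_iff_eq_bot.1 h1, Submodule.subsingleton_iff_eq_bot.1 h2⟩
  · rintro ⟨x, y⟩
    exact map_add X.μ _ _
  · rintro ⟨x, y⟩
    exact map_add X.ν _ _

theorem Indecomposable.isIsomorphic_zeroTZero_zero {X : TsfPair.{u, w} K}
    (hX : X.Indecomposable) {e : X.E} (he : e ≠ 0) (hμ : X.μ e = 0) (hν : X.ν e = 0) :
    X.IsIsomorphic (zeroTZero K 0) := by
  obtain ⟨P', hP'⟩ := (K ∙ e).exists_isCompl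
  obtain ⟨h1, h2⟩ := hX.eq_bot_of_isCompl hP' isCompl_bot_top
    ((Submodule.span_singleton_le_iff_mem _ _).2 (by simpa using hμ))
    ((Submodule.span_singleton_le_iff_mem _ _).2 (by simpa using hν)) (by simp) (by simp)
    (by simpa using he)
  have : Subsingleton X.V := (Submodule.subsingleton_iff K).1 (subsingleton_of_bot_eq_top h2.symm)
  have htop : K ∙ e = ⊤ := by simpa [h1] using hP'.sup_eq_top
  have hE : Module.finrank K X.E = Module.finrank K (Fin 1 → K) := by
    rw [← finrank_top, ← htop, finrank_span_singleton he, Module.finrank_fin_fun]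
  have : Subsingleton (zeroTZero K 0).V := inferInstanceAs (Subsingleton (Fin 0 → K))
  let α : X.E ≃ₗ[K] (Fin 1 → K) := LinearEquiv.ofFinrankEq _ _ hE
  exact ⟨α, (0 : X.V ≃ₗ[K] (zeroTZero K 0).V),
    fun _ => Subsingleton.elim _ _, fun _ => Subsingleton.elim _ _⟩

/-- A functional φ that vanishes on the range of ν but not at μ e yields the complement (ker (φ ∘
μ), ker φ) of the lines through e and μ e; ν maps everything into ker φ. -/
theorem Indecomposable.isIsomorphic_TZero_one {X : TsfPair.{u, w} K}
    (hX : X.Indecomposable) {e : X.E} (hν : X.ν e = 0) (hμ : X.μ e ∉ LinearMap.range X.ν) :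
    X.IsIsomorphic (TZero K 1) := by
  obtain ⟨φ, hφ, hφν⟩ := Submodule.exists_le_ker_of_notMem hμ
  have hφν' : ∀ x, φ (X.ν x) = 0 := fun x => hφν ⟨x, rfl⟩
  have he : e ≠ 0 := by
    rintro rfl
    simp at hφ
  have compl : ∀ {M : Type w} [AddCommGroup M] [Module K M] (f : M →ₗ[K] K) (x : M), f x ≠ 0 →
      IsCompl (K ∙ x) (LinearMap.ker f) := by
    intro M _ _ f x hx
    refine ⟨?_, ?_⟩
    · rw [Submodule.disjoint_def]
      intro y hy hy'
      obtain ⟨c, rfl⟩ := Submodule.mem_span_singleton.1 hy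
      have : c = 0 := by simpa [hx] using hy'
      simp [this]
    · rw [codisjoint_iff, eq_top_iff]
      intro y _
      refine Submodule.mem_sup.2 ⟨(f y / f x) • x, Submodule.mem_span_singleton.2 ⟨_, rfl⟩,
        y - (f y / f x) • x, ?_, by abel⟩
      simp [hx]
  have h1 := compl (φ ∘ₗ X.μ) e hφ
  have h2 := compl φ (X.μ e) hφ
  obtain ⟨hE, hV⟩ := hX.eq_bot_of_isCompl h1 h2
    ((Submodule.span_singleton_le_iff_mem _ _).2 (Submodule.mem_span_singleton_self _))
    ((Submodule.span_singleton_le_iff_mem _ _).2 (by simp [hν])) (fun x hx => hx)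
    (fun x _ => hφν' x) (by simpa using he)
  have hν0 : ∀ x, X.ν x = 0 := fun x => by
    have : X.ν x ∈ LinearMap.ker φ := hφν' x
    rwa [hV, Submodule.mem_bot] at this
  have hbij : Function.Bijective X.μ := by
    refine ⟨(injective_iff_map_eq_zero _).2 fun x hx => ?_, fun y => ?_⟩
    · have : x ∈ LinearMap.ker (φ ∘ₗ X.μ) := by simp [hx]
      rwa [hE, Submodule.mem_bot] at this
    · have : y ∈ K ∙ X.μ e := by
        rw [show K ∙ X.μ e = ⊤ by simpa [hV] using h2.sup_eq_top]
        trivial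
      obtain ⟨c, rfl⟩ := Submodule.mem_span_singleton.1 this
      exact ⟨c • e, map_smul _ _ _⟩
  have hfin : Module.finrank K X.V = Module.finrank K (Fin 1 → K) := by
    rw [← finrank_top, ← show K ∙ X.μ e = ⊤ by simpa [hV] using h2.sup_eq_top,
      finrank_span_singleton, Module.finrank_fin_fun]
    intro h0
    simp [h0] at hφ
  let β : X.V ≃ₗ[K] (Fin 1 → K) := LinearEquiv.ofFinrankEq _ _ hfin
  refine ⟨(LinearEquiv.ofBijective X.μ hbij).trans β, β, fun x => rfl, fun x => ?_⟩
  have h0 : β (X.ν x) = 0 := by rw [hν0, map_zero]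
  refine Eq.trans (funext fun j => ?_) h0.symm
  rw [Subsingleton.elim j 0]
  exact nilp_apply_zero K 0 _

/-! ### Rebuilding a pair from its quotient by ker ν and μ(ker ν). -/

/-- The transformation-pair `[μ × 1, (ν, p) : E × W → V × W]` obtained from `X = [μ, ν : E → V]`
and `p : E → W`. -/
def extend (X : TsfPair.{u, w} K) (W : Type w) [AddCommGroup W] [Module K W] [Module.Finite K W]
    (p : X.E →ₗ[K] W) : TsfPair.{u, w} K where
  E := X.E × W
  V := X.V × W
  μ := X.μ.prodMap LinearMap.id
  ν := (X.ν.prod p) ∘ₗ LinearMap.fst K X.E W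

/-- The map `p` identifies the kernel of `ν` with `W`. -/
def IdentifiesKer (X : TsfPair.{u, w} K) {W : Type w'} [AddCommGroup W] [Module K W]
    (p : X.E →ₗ[K] W) : Prop :=
  (∀ e, X.ν e = 0 → p e = 0 → e = 0) ∧ ∀ x, ∃ e, X.ν e = 0 ∧ p e = x

theorem exists_comp_eq_of_ker_le_ker {M N P : Type*} [AddCommGroup M] [Module K M] [AddCommGroup N]
    [Module K N] [AddCommGroup P] [Module K P] (f : M →ₗ[K] N) (g : M →ₗ[K] P)
    (h : ∀ x, f x = 0 → g x = 0) : ∃ k : N →ₗ[K] P, ∀ x, k (f x) = g x := by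
  obtain ⟨s, hs⟩ := LinearMap.exists_rightInverse_of_surjective f.rangeRestrict
    f.range_rangeRestrict
  obtain ⟨k, hk⟩ := LinearMap.exists_extend (g ∘ₗ s)
  refine ⟨k, fun x => ?_⟩
  have h1 : k (f x) = g (s (f.rangeRestrict x)) := LinearMap.congr_fun hk (f.rangeRestrict x)
  have h2 : f (s (f.rangeRestrict x)) = f x :=
    congrArg Subtype.val (LinearMap.congr_fun hs (f.rangeRestrict x))
  rw [h1, ← sub_eq_zero, ← map_sub]
  exact h _ (by rw [map_sub, h2, sub_self])

/-- The choice of p does not matter. With σ : W ≃ W' the comparison through the kernels of the two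
ν, the defect p' ∘ α - σ ∘ p vanishes on ker ν, so it is k ∘ ν for some k, and a shear by k absorbs
it. -/
theorem extend_isIsomorphic {X : TsfPair.{u, w} K} {Y : TsfPair.{u, w'} K}
    {W : Type w} [AddCommGroup W] [Module K W] [Module.Finite K W]
    {W' : Type w'} [AddCommGroup W'] [Module K W'] [Module.Finite K W']
    {p : X.E →ₗ[K] W} {p' : Y.E →ₗ[K] W'} (h : X.IsIsomorphic Y)
    (hp : X.IdentifiesKer p) (hp' : Y.IdentifiesKer p') :
    (X.extend W p).IsIsomorphic (Y.extend W' p') := by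
  obtain ⟨α, β, hμ, hν⟩ := h
  have hbij : Function.Bijective (p ∘ₗ (LinearMap.ker X.ν).subtype) := by
    refine ⟨(injective_iff_map_eq_zero _).2 fun e he => Subtype.ext (hp.1 e e.2 he), fun x => ?_⟩
    obtain ⟨e, he, rfl⟩ := hp.2 x
    exact ⟨⟨e, he⟩, rfl⟩
  let τ := LinearEquiv.ofBijective _ hbij
  let s : W →ₗ[K] X.E := (LinearMap.ker X.ν).subtype ∘ₗ τ.symm.toLinearMap
  have hνs : ∀ x, X.ν (s x) = 0 := fun x => (τ.symm x).2
  have hps : ∀ x, p (s x) = x := fun x => τ.apply_symm_apply x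
  have hsp : ∀ e, X.ν e = 0 → s (p e) = e := fun e he =>
    congrArg Subtype.val (τ.symm_apply_apply ⟨e, he⟩)
  have hσ : Function.Bijective (p' ∘ₗ α.toLinearMap ∘ₗ s) := by
    refine ⟨(injective_iff_map_eq_zero _).2 fun x hx => ?_, fun y => ?_⟩
    · have h0 : α (s x) = 0 := hp'.1 _ (by rw [hν, hνs, map_zero]) hx
      rw [← hps x, α.map_eq_zero_iff.1 h0, map_zero]
    · obtain ⟨e, he, rfl⟩ := hp'.2 y
      have he' : X.ν (α.symm e) = 0 := by
        apply β.injective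
        rw [← hν, α.apply_symm_apply, he, map_zero]
      refine ⟨p (α.symm e), ?_⟩
      simp [hsp _ he']
  let σ : W ≃ₗ[K] W' := LinearEquiv.ofBijective _ hσ
  have hσ' : ∀ e, X.ν e = 0 → σ (p e) = p' (α e) := fun e he => by
    change p' (α (s (p e))) = _
    rw [hsp e he]
  obtain ⟨k, hk⟩ := exists_comp_eq_of_ker_le_ker X.ν
    (p' ∘ₗ α.toLinearMap - σ.toLinearMap ∘ₗ p) fun e he => by simp [hσ' e he]
  refine ⟨α.skewProd σ (k ∘ₗ X.μ), β.skewProd σ k, fun x => ?_, fun x => ?_⟩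
  · exact Prod.ext (hμ x.1) rfl
  · refine Prod.ext (hν x.1) ?_
    change p' (α x.1) = σ (p x.1) + k (X.ν x.1)
    rw [hk]
    simp

/-- Retractions r onto ker ν and s of μ restricted to ker ν have kernels that model E / ker ν and V
/ μ(ker ν); Y is the induced pair and p is s ∘ ν. The range hypothesis makes p map the kernel of the
new ν onto ker ν. -/
theorem exists_isIsomorphic_extend {X : TsfPair.{u, w} K}
    (hinj : ∀ e, X.μ e = 0 → X.ν e = 0 → e = 0)
    (hrange : ∀ e, X.ν e = 0 → X.μ e ∈ LinearMap.range X.ν) :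
    ∃ (Y : TsfPair.{u, w} K) (p : Y.E →ₗ[K] LinearMap.ker X.ν),
      Y.IdentifiesKer p ∧ X.IsIsomorphic (Y.extend _ p) := by
  obtain ⟨r, hr⟩ := (LinearMap.ker X.ν).subtype.exists_leftInverse_of_injective
    (Submodule.ker_subtype _)
  obtain ⟨s, hs⟩ := (X.μ ∘ₗ (LinearMap.ker X.ν).subtype).exists_leftInverse_of_injective
    (LinearMap.ker_eq_bot'.2 fun e he => Subtype.ext (hinj e he e.2))
  replace hr : ∀ e : LinearMap.ker X.ν, r e = e := fun e => LinearMap.congr_fun hr e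
  replace hs : ∀ e : LinearMap.ker X.ν, s (X.μ e) = e := fun e => LinearMap.congr_fun hs e
  have hνr : ∀ e, X.ν (r e) = 0 := fun e => (r e).2
  let P : X.E →ₗ[K] LinearMap.ker r :=
    (LinearMap.id - (LinearMap.ker X.ν).subtype ∘ₗ r).codRestrict _ fun e => by simp [hr]
  let Q : X.V →ₗ[K] LinearMap.ker s :=
    (LinearMap.id - X.μ ∘ₗ (LinearMap.ker X.ν).subtype ∘ₗ s).codRestrict _ fun e => by simp [hs]
  have hP : ∀ e, (P e : X.E) = e - r e := fun e => rfl
  have hQ : ∀ v, (Q v : X.V) = v - X.μ (s v) := fun v => rfl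
  -- The second component is s ∘ μ rather than r, so that μ becomes the identity on the
  -- W-components.
  have hα : Function.Bijective (P.prod (s ∘ₗ X.μ)) := by
    refine ⟨(injective_iff_map_eq_zero _).2 fun e he => ?_, fun ⟨c, x⟩ => ?_⟩
    · have h1 : e = r e := sub_eq_zero.1 (congrArg (fun z => (z.1 : X.E)) he)
      have h2 : s (X.μ e) = 0 := congrArg Prod.snd he
      rw [h1, hs] at h2
      rw [h1, h2]
      rfl
    · have hc : r c = 0 := c.2
      refine ⟨c + x - s (X.μ c), Prod.ext (Subtype.ext ?_) ?_⟩
      · change (P _ : X.E) = c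
        rw [hP]
        simp only [map_add, map_sub, hr, hc]
        simp
      · change s (X.μ _) = x
        simp only [map_add, map_sub, hs]
        simp
  have hβ : Function.Bijective (Q.prod s) := by
    refine ⟨(injective_iff_map_eq_zero _).2 fun v hv => ?_, fun ⟨c, x⟩ => ?_⟩
    · have h1 : v = X.μ (s v) := sub_eq_zero.1 (congrArg (fun z => (z.1 : X.V)) hv)
      have h2 : s v = 0 := congrArg Prod.snd hv
      rw [h1, h2]
      simp
    · have hc : s c = 0 := c.2
      refine ⟨c + X.μ x, Prod.ext (Subtype.ext ?_) ?_⟩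
      · change (Q _ : X.V) = c
        rw [hQ]
        simp only [map_add, hs, hc]
        simp
      · change s _ = x
        simp only [map_add, hs, hc]
        simp
  let Y : TsfPair.{u, w} K :=
    { E := LinearMap.ker r
      V := LinearMap.ker s
      μ := Q ∘ₗ X.μ ∘ₗ (LinearMap.ker r).subtype
      ν := Q ∘ₗ X.ν ∘ₗ (LinearMap.ker r).subtype }
  refine ⟨Y, s ∘ₗ X.ν ∘ₗ (LinearMap.ker r).subtype, ⟨?_, ?_⟩,
    LinearEquiv.ofBijective _ hα, LinearEquiv.ofBijective _ hβ, fun e => ?_, fun e => ?_⟩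
  · intro c hc hc'
    have h1 : Q (X.ν c.1) = 0 := hc
    have h2 : s (X.ν c.1) = 0 := hc'
    have h3 : X.ν c.1 - X.μ (s (X.ν c.1)) = 0 := by rw [← hQ, h1]; rfl
    rw [h2, ZeroMemClass.coe_zero, map_zero, sub_zero] at h3
    have h4 := hr ⟨c.1, h3⟩
    have h5 : r c.1 = 0 := c.2
    rw [h5] at h4
    exact Subtype.ext (congrArg (fun z : LinearMap.ker X.ν => (z : X.E)) h4.symm)
  · intro x
    obtain ⟨e, he⟩ := hrange x x.2
    have hPe : X.ν (P e) = X.μ x := by rw [hP, map_sub, hνr, sub_zero, he]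
    refine ⟨P e, ?_, ?_⟩
    · change Q (X.ν (P e)) = 0
      refine Subtype.ext ?_
      rw [hQ, hPe, hs, sub_self]
      rfl
    · change s (X.ν (P e)) = x
      rw [hPe, hs]
  · refine Prod.ext ?_ rfl
    change Q (X.μ (P e)) = Q (X.μ e)
    refine Subtype.ext ?_
    rw [hQ, hQ, hP]
    simp only [map_sub, hs]
    simp
  · change (Q (X.ν (P e)), s (X.ν (P e))) = (Q (X.ν e), s (X.ν e))
    rw [hP, map_sub, hνr, sub_zero]

theorem exists_identifiesKer (X : TsfPair.{u, w} K) :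
    ∃ p : X.E →ₗ[K] LinearMap.ker X.ν, X.IdentifiesKer p := by
  obtain ⟨r, hr⟩ := (LinearMap.ker X.ν).subtype.exists_leftInverse_of_injective
    (Submodule.ker_subtype _)
  replace hr : ∀ e : LinearMap.ker X.ν, r e = e := fun e => LinearMap.congr_fun hr e
  refine ⟨r, fun e he h => ?_, fun x => ⟨x, x.2, hr x⟩⟩
  have := hr ⟨e, he⟩
  rw [h] at this
  exact congrArg Subtype.val this.symm

/-- A splitting of X extends to one of its extension: choose p on both summands and use that
extensions do not depend on the choice. -/
theorem Indecomposable.of_extend {X : TsfPair.{u, w} K} {W : Type w} [AddCommGroup W]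
    [Module K W] [Module.Finite K W] {p : X.E →ₗ[K] W} (hp : X.IdentifiesKer p)
    (h : (X.extend W p).Indecomposable) : X.Indecomposable := by
  constructor
  · rintro ⟨_, _⟩
    have : Subsingleton W := by
      refine ⟨fun x y => ?_⟩
      obtain ⟨e, -, rfl⟩ := hp.2 x
      obtain ⟨e', -, rfl⟩ := hp.2 y
      rw [Subsingleton.elim e e']
    exact h.1 ⟨inferInstanceAs (Subsingleton (X.E × W)), inferInstanceAs (Subsingleton (X.V × W))⟩
  · intro A B hA hB hAB
    obtain ⟨p₁, h₁⟩ := A.exists_identifiesKer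
    obtain ⟨p₂, h₂⟩ := B.exists_identifiesKer
    have h₁₂ : (A.directSum B).IdentifiesKer (p₁.prodMap p₂) := by
      constructor
      · rintro ⟨x, y⟩ hν h0
        exact Prod.ext (h₁.1 x (congrArg Prod.fst hν) (congrArg Prod.fst h0))
          (h₂.1 y (congrArg Prod.snd hν) (congrArg Prod.snd h0))
      · rintro ⟨x, y⟩
        obtain ⟨e, he, rfl⟩ := h₁.2 x
        obtain ⟨e', he', rfl⟩ := h₂.2 y
        exact ⟨(e, e'), Prod.ext he he', rfl⟩
    have hne : ∀ (C : TsfPair.{u, w} K) (q : C.E →ₗ[K] LinearMap.ker C.ν), ¬ C.IsZero →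
        ¬ (C.extend _ q).IsZero := by
      rintro C q hC ⟨h1, h2⟩
      exact hC ⟨@Function.Injective.subsingleton _ _ _
          (Prod.mk_left_injective (0 : LinearMap.ker C.ν)) h1,
        @Function.Injective.subsingleton _ _ _
          (Prod.mk_left_injective (0 : LinearMap.ker C.ν)) h2⟩
    exact h.2 (A.extend _ p₁) (B.extend _ p₂) (hne A p₁ hA) (hne B p₂ hB)
      ((extend_isIsomorphic hAB hp h₁₂).trans
        ⟨LinearEquiv.prodProdProdComm K A.E B.E _ _, LinearEquiv.prodProdProdComm K A.V B.V _ _,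
          fun _ => rfl, fun _ => rfl⟩)

/-! ### The types as iterated extensions, and the classification. -/

theorem bijective_castSucc_last (n : ℕ) :
    Function.Bijective ((LinearMap.funLeft K K (Fin.castSucc : Fin n → Fin (n + 1))).prod
      (LinearMap.proj (Fin.last n))) := by
  refine ⟨fun x y h => funext fun j => ?_, fun ⟨x, c⟩ => ⟨Fin.snoc x c, ?_⟩⟩
  · refine Fin.lastCases ?_ (fun i => ?_) j
    · exact congrArg Prod.snd h
    · exact congrFun (congrArg Prod.fst h) i
  · refine Prod.ext (funext fun j => ?_) ?_
    · exact Fin.snoc_castSucc (α := fun _ => K) _ _ _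
    · exact Fin.snoc_last (α := fun _ => K) _ _

theorem bijective_succ_zero (n : ℕ) :
    Function.Bijective ((LinearMap.funLeft K K (Fin.succ : Fin n → Fin (n + 1))).prod
      (LinearMap.proj 0)) := by
  refine ⟨fun x y h => funext fun j => ?_, fun ⟨x, c⟩ => ⟨Fin.cons c x, rfl⟩⟩
  refine Fin.cases ?_ (fun i => ?_) j
  · exact congrArg Prod.snd h
  · exact congrFun (congrArg Prod.fst h) i

theorem identifiesKer_TZero (n : ℕ) : (TZero K (n + 1)).IdentifiesKer
    (LinearMap.proj (Fin.last n) : (Fin (n + 1) → K) →ₗ[K] K) := by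
  constructor
  · intro x hx h0
    refine funext fun j => Fin.lastCases h0 (fun i => ?_) j
    exact (nilp_apply_succ K n x i).symm.trans (congrFun hx i.succ)
  · intro c
    refine ⟨(Pi.single (Fin.last n) c : Fin (n + 1) → K), funext fun j => ?_,
      Pi.single_eq_same (M := fun _ => K) _ _⟩
    refine Fin.cases (nilp_apply_zero K n _) (fun i => ?_) j
    refine (nilp_apply_succ K n _ i).trans ?_
    exact Pi.single_eq_of_ne (Fin.castSucc_lt_last i).ne _

theorem TZero_succ_isIsomorphic_extend (n : ℕ) : (TZero K (n + 2)).IsIsomorphic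
    ((TZero K (n + 1)).extend K (LinearMap.proj (Fin.last n) : (Fin (n + 1) → K) →ₗ[K] K)) := by
  refine ⟨LinearEquiv.ofBijective _ (bijective_castSucc_last (n + 1)),
    LinearEquiv.ofBijective _ (bijective_castSucc_last (n + 1)), fun x => rfl, fun x => ?_⟩
  refine Prod.ext (funext fun j => ?_) ?_
  · refine Fin.cases ?_ (fun i => ?_) j
    · exact (nilp_apply_zero K n _).trans (nilp_apply_zero K (n + 1) _).symm
    · exact (nilp_apply_succ K n _ i).trans (nilp_apply_succ K (n + 1) _ i.castSucc).symm
  · exact (nilp_apply_succ K (n + 1) _ (Fin.last n)).symm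

theorem identifiesKer_zeroTZero (n : ℕ) : (zeroTZero K n).IdentifiesKer
    (LinearMap.proj 0 : (Fin (n + 1) → K) →ₗ[K] K) := by
  constructor
  · intro x hx h0
    refine funext fun j => Fin.cases h0 (fun i => ?_) j
    exact congrFun ((zeroTZero_ν_apply K n x).symm.trans hx) i
  · intro c
    refine ⟨(Pi.single 0 c : Fin (n + 1) → K), (zeroTZero_ν_apply K n _).trans
      (funext fun j => ?_), Pi.single_eq_same (M := fun _ : Fin (n + 1) => K) 0 c⟩
    exact Pi.single_eq_of_ne (Fin.succ_ne_zero j) _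

/-- The new coordinate is the first one, which spans ker ν; for Tₙ⁰ it is the last. -/
theorem zeroTZero_succ_isIsomorphic_extend (n : ℕ) : (zeroTZero K (n + 1)).IsIsomorphic
    ((zeroTZero K n).extend K (LinearMap.proj 0 : (Fin (n + 1) → K) →ₗ[K] K)) := by
  refine ⟨LinearEquiv.ofBijective _ (bijective_succ_zero (n + 1)),
    LinearEquiv.ofBijective _ (bijective_succ_zero n), fun x => ?_, fun x => ?_⟩
  · refine Prod.ext ((zeroTZero_μ_apply K n _).trans (funext fun j => ?_)) ?_
    · exact (congrFun (zeroTZero_μ_apply K (n + 1) x) j.succ).symm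
    · exact (congrFun (zeroTZero_μ_apply K (n + 1) x) 0).symm
  · refine Prod.ext ((zeroTZero_ν_apply K n _).trans (funext fun j => ?_)) ?_
    · exact (congrFun (zeroTZero_ν_apply K (n + 1) x) j.succ).symm
    · exact (congrFun (zeroTZero_ν_apply K (n + 1) x) 0).symm

theorem zeroTZero_swap_isIsomorphic (n : ℕ) :
    (zeroTZero K n).swap.IsIsomorphic (zeroTZero K n) := by
  refine ⟨LinearEquiv.funCongrLeft K K Fin.revPerm, LinearEquiv.funCongrLeft K K Fin.revPerm,
    fun x => ?_, fun x => ?_⟩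
  · refine (zeroTZero_μ_apply K n _).trans (funext fun j => ?_)
    refine Eq.trans ?_ (congrFun (zeroTZero_ν_apply K n x) j.rev).symm
    exact congrArg x (Fin.rev_castSucc j)
  · refine (zeroTZero_ν_apply K n _).trans (funext fun j => ?_)
    refine Eq.trans ?_ (congrFun (zeroTZero_μ_apply K n x) j.rev).symm
    exact congrArg x (Fin.rev_succ j)

/-- A kernel vector common to μ and ν gives ⁰T₀⁰, and a vector of ker ν with μ-image outside the
range of ν gives T₁⁰. Otherwise X is an extension of an indecomposable Y with smaller E, and the
types are closed under extension. -/
theorem Indecomposable.classification_of_ker_ν_ne_bot (d : ℕ) : ∀ X : TsfPair.{u, w} K,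
    Module.finrank K X.E = d → X.Indecomposable → LinearMap.ker X.ν ≠ ⊥ →
    (∃ n, X.IsIsomorphic (TZero K (n + 1))) ∨ ∃ n, X.IsIsomorphic (zeroTZero K n) := by
  induction d using Nat.strong_induction_on with
  | _ d ih =>
    intro X hd hX hker
    by_cases hinj : ∀ e, X.μ e = 0 → X.ν e = 0 → e = 0
    swap
    · push Not at hinj
      obtain ⟨e, hμ, hν, he⟩ := hinj
      exact Or.inr ⟨0, hX.isIsomorphic_zeroTZero_zero he hμ hν⟩
    by_cases hrange : ∀ e, X.ν e = 0 → X.μ e ∈ LinearMap.range X.ν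
    swap
    · push Not at hrange
      obtain ⟨e, hν, hμ⟩ := hrange
      exact Or.inl ⟨0, hX.isIsomorphic_TZero_one hν hμ⟩
    obtain ⟨Y, p, hp, hXY⟩ := exists_isIsomorphic_extend hinj hrange
    have hlt : Module.finrank K Y.E < d := by
      obtain ⟨α, -⟩ := hXY
      have h1 : Module.finrank K X.E =
          Module.finrank K Y.E + Module.finrank K (LinearMap.ker X.ν) :=
        α.finrank_eq.trans Module.finrank_prod
      have h2 : 0 < Module.finrank K (LinearMap.ker X.ν) :=
        Nat.pos_of_ne_zero fun h => hker (Submodule.finrank_eq_zero.1 h)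
      omega
    -- The induction can go on because p maps the kernel of `Y.ν` onto that of `X.ν`.
    have hY : LinearMap.ker Y.ν ≠ ⊥ := by
      intro h
      apply hker
      rw [eq_bot_iff]
      intro x hx
      obtain ⟨e, he, hpe⟩ := hp.2 ⟨x, hx⟩
      have he0 : e = 0 := LinearMap.ker_eq_bot'.1 h e he
      rw [he0, map_zero] at hpe
      exact (congrArg Subtype.val hpe).symm
    obtain ⟨n, hn⟩ | ⟨n, hn⟩ :=
      ih _ hlt Y rfl (Indecomposable.of_extend hp (hX.of_isIsomorphic hXY)) hY
    · exact Or.inl ⟨n + 1, (hXY.trans (extend_isIsomorphic hn hp (identifiesKer_TZero n))).trans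
        (TZero_succ_isIsomorphic_extend n).symm⟩
    · exact Or.inr ⟨n + 1, (hXY.trans (extend_isIsomorphic hn hp
        (identifiesKer_zeroTZero n))).trans (zeroTZero_succ_isIsomorphic_extend n).symm⟩

theorem Indecomposable.classification {X : TsfPair.{u, w} K} (hX : X.Indecomposable) :
    (LinearMap.ker X.μ = ⊥ ∧ LinearMap.ker X.ν = ⊥) ∨
      (∃ n, X.IsIsomorphic (TZero K (n + 1))) ∨ (∃ n, X.IsIsomorphic (zeroT K (n + 1))) ∨
      ∃ n, X.IsIsomorphic (zeroTZero K n) := by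
  by_cases hν : LinearMap.ker X.ν = ⊥
  · by_cases hμ : LinearMap.ker X.μ = ⊥
    · exact Or.inl ⟨hμ, hν⟩
    · obtain ⟨n, hn⟩ | ⟨n, hn⟩ :=
        Indecomposable.classification_of_ker_ν_ne_bot _ X.swap rfl hX.swap hμ
      -- Swapping Tₙ⁰ gives ⁰Tₙ by definition, whereas ⁰Tₙ⁰ is its own swap only after reversing
      -- coordinates.
      · exact Or.inr (Or.inr (Or.inl ⟨n, hn.swap⟩))
      · exact Or.inr (Or.inr (Or.inr ⟨n, hn.swap.trans (zeroTZero_swap_isIsomorphic n)⟩))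
  · obtain h | h := Indecomposable.classification_of_ker_ν_ne_bot _ X rfl hX hν
    · exact Or.inr (Or.inl h)
    · exact Or.inr (Or.inr (Or.inr h))

theorem corank_alternatingSum_eq_zero {κ : TsfPair.{u, u} K} {a b c d : ℕ × ℕ}
    (hT : ∀ n, TZero K (n + 1) = κ ∨
      (n + 1 - a.2 : ℕ) - (n + 1 - b.2 : ℕ) - (n + 1 - c.2 : ℕ) + (n + 1 - d.2 : ℕ) = (0 : ℤ))
    (hT' : ∀ n, zeroT K (n + 1) = κ ∨
      (n + 1 - a.1 : ℕ) - (n + 1 - b.1 : ℕ) - (n + 1 - c.1 : ℕ) + (n + 1 - d.1 : ℕ) = (0 : ℤ))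
    (hZ : ∀ n, zeroTZero K n = κ ∨ (n - a.2 - a.1 : ℕ) - (n - b.2 - b.1 : ℕ) -
      (n - c.2 - c.1 : ℕ) + (n - d.2 - d.1 : ℕ) = (0 : ℤ))
    (X : TsfPair.{u, w} K) (hX : X.Indecomposable) (hκ : ¬ X.IsIsomorphic κ) :
    corank a.1 a.2 X - corank b.1 b.2 X - corank c.1 c.2 X + corank d.1 d.2 X = 0 := by
  obtain ⟨hμ, hν⟩ | ⟨n, hn⟩ | ⟨n, hn⟩ | ⟨n, hn⟩ := hX.classification
  · rw [corank_eq_of_injective hμ hν a.1, corank_eq_of_injective hμ hν b.1,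
      corank_eq_of_injective hμ hν c.1, corank_eq_of_injective hμ hν d.1]
    ring
  · simp only [hn.corank_eq, corank_TZero]
    exact (hT n).resolve_left fun h => hκ (h ▸ hn)
  · simp only [hn.corank_eq, corank_zeroT]
    exact (hT' n).resolve_left fun h => hκ (h ▸ hn)
  · simp only [hn.corank_eq, corank_zeroTZero]
    exact (hZ n).resolve_left fun h => hκ (h ▸ hn)

end TsfPair

end Kronecker

namespace Kronecker

namespace TsfPair

variable {K : Type u} [Field K]

/-! ### Multiplicities from identities between truncated differences. -/

theorem hasMultiplicity_TZero {n : ℕ} {a b c d : ℕ × ℕ}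
    (h : ∀ k, (k + 1 - a.2 : ℕ) - (k + 1 - b.2 : ℕ) - (k + 1 - c.2 : ℕ) + (k + 1 - d.2 : ℕ) =
      if k = n then (1 : ℤ) else 0)
    (h' : ∀ k, (k + 1 - a.1 : ℕ) - (k + 1 - b.1 : ℕ) - (k + 1 - c.1 : ℕ) + (k + 1 - d.1 : ℕ) =
      (0 : ℤ))
    (h'' : ∀ k, (k - a.2 - a.1 : ℕ) - (k - b.2 - b.1 : ℕ) - (k - c.2 - c.1 : ℕ) +
      (k - d.2 - d.1 : ℕ) = (0 : ℤ)) (π : TsfPair.{u, w} K) :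
    π.HasMultiplicity (TZero K (n + 1))
      (corank a.1 a.2 π - corank b.1 b.2 π - corank c.1 c.2 π + corank d.1 d.2 π) := by
  refine hasMultiplicity_of_corank ?_ (corank_alternatingSum_eq_zero (fun k => ?_)
    (fun k => Or.inr (h' k)) (fun k => Or.inr (h'' k))) π
  · simp only [corank_TZero, h n, if_true]
  · by_cases hk : k = n
    · exact Or.inl (by rw [hk])
    · exact Or.inr ((h k).trans (if_neg hk))

theorem hasMultiplicity_zeroT {n : ℕ} {a b c d : ℕ × ℕ}
    (h : ∀ k, (k + 1 - a.2 : ℕ) - (k + 1 - b.2 : ℕ) - (k + 1 - c.2 : ℕ) + (k + 1 - d.2 : ℕ) =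
      (0 : ℤ))
    (h' : ∀ k, (k + 1 - a.1 : ℕ) - (k + 1 - b.1 : ℕ) - (k + 1 - c.1 : ℕ) + (k + 1 - d.1 : ℕ) =
      if k = n then (1 : ℤ) else 0)
    (h'' : ∀ k, (k - a.2 - a.1 : ℕ) - (k - b.2 - b.1 : ℕ) - (k - c.2 - c.1 : ℕ) +
      (k - d.2 - d.1 : ℕ) = (0 : ℤ)) (π : TsfPair.{u, w} K) :
    π.HasMultiplicity (zeroT K (n + 1))
      (corank a.1 a.2 π - corank b.1 b.2 π - corank c.1 c.2 π + corank d.1 d.2 π) := by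
  refine hasMultiplicity_of_corank ?_ (corank_alternatingSum_eq_zero (fun k => Or.inr (h k))
    (fun k => ?_) (fun k => Or.inr (h'' k))) π
  · simp only [corank_zeroT, h' n, if_true]
  · by_cases hk : k = n
    · exact Or.inl (by rw [hk])
    · exact Or.inr ((h' k).trans (if_neg hk))

theorem hasMultiplicity_zeroTZero {n : ℕ} {a b c d : ℕ × ℕ}
    (h : ∀ k, (k + 1 - a.2 : ℕ) - (k + 1 - b.2 : ℕ) - (k + 1 - c.2 : ℕ) + (k + 1 - d.2 : ℕ) =
      (0 : ℤ))
    (h' : ∀ k, (k + 1 - a.1 : ℕ) - (k + 1 - b.1 : ℕ) - (k + 1 - c.1 : ℕ) + (k + 1 - d.1 : ℕ) =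
      (0 : ℤ))
    (h'' : ∀ k, (k - a.2 - a.1 : ℕ) - (k - b.2 - b.1 : ℕ) - (k - c.2 - c.1 : ℕ) +
      (k - d.2 - d.1 : ℕ) = if k = n then (1 : ℤ) else 0) (π : TsfPair.{u, w} K) :
    π.HasMultiplicity (zeroTZero K n)
      (corank a.1 a.2 π - corank b.1 b.2 π - corank c.1 c.2 π + corank d.1 d.2 π) := by
  refine hasMultiplicity_of_corank ?_ (corank_alternatingSum_eq_zero (fun k => Or.inr (h k))
    (fun k => Or.inr (h' k)) (fun k => ?_)) π
  · simp only [corank_zeroTZero, h'' n, if_true]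
  · by_cases hk : k = n
    · exact Or.inl (by rw [hk])
    · exact Or.inr ((h'' k).trans (if_neg hk))

end TsfPair

end Kronecker

theorem theorem5p4 {K : Type u} [Field K] (Γ : BinRel.{v}) [Finite Γ.S] :
    (∀ n : ℕ, 1 ≤ n →
      (linearization K Γ).HasMultiplicity (TZero K n)
        (gamma (n + 1) (n - 1) Γ - gamma n n Γ - gamma (n + 1) n Γ + gamma n (n + 1) Γ) ∧
      (linearization K Γ).HasMultiplicity (TZero K n)
        (gamma (n - 1) (n + 1) Γ - gamma n n Γ - gamma (n - 1) n Γ + gamma n (n - 1) Γ) ∧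
      (linearization K Γ).HasMultiplicity (zeroT K n)
        (gamma (n - 1) (n + 1) Γ - gamma n n Γ - gamma n (n + 1) Γ + gamma (n + 1) n Γ) ∧
      (linearization K Γ).HasMultiplicity (zeroT K n)
        (gamma (n + 1) (n - 1) Γ - gamma n n Γ - gamma n (n - 1) Γ + gamma (n - 1) n Γ)) ∧
    (∀ p : ℕ,
      (linearization K Γ).HasMultiplicity (zeroTZero K (2 * p + 1))
        (gamma p p Γ - gamma p (p + 1) Γ - gamma (p + 1) p Γ + gamma (p + 1) (p + 1) Γ)) ∧
    (∀ p : ℕ, 1 ≤ p →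
      (linearization K Γ).HasMultiplicity (zeroTZero K (2 * p))
        (gamma p (p - 1) Γ - gamma p p Γ - gamma (p + 1) (p - 1) Γ + gamma (p + 1) p Γ) ∧
      (linearization K Γ).HasMultiplicity (zeroTZero K (2 * p))
        (gamma (p - 1) p Γ - gamma p p Γ - gamma (p - 1) (p + 1) Γ + gamma p (p + 1) Γ)) := by
  simp only [gamma_eq_corank (K := K)]
  refine ⟨fun n hn => ?_, fun p => ?_, fun p hp => ?_⟩
  -- The shift matches the indexing of the multiplicity lemmas by n + 1. The pairs a, b, c, d are
  -- read off from the goal, and what remains is arithmetic with truncated subtraction.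
  · obtain ⟨n, rfl⟩ := Nat.exists_eq_add_of_le' hn
    refine ⟨TsfPair.hasMultiplicity_TZero (a := (_, _)) (b := (_, _)) (c := (_, _)) (d := (_, _))
        (fun k => ?_) (fun k => ?_) (fun k => ?_) _,
      TsfPair.hasMultiplicity_TZero (a := (_, _)) (b := (_, _)) (c := (_, _)) (d := (_, _))
        (fun k => ?_) (fun k => ?_) (fun k => ?_) _,
      TsfPair.hasMultiplicity_zeroT (a := (_, _)) (b := (_, _)) (c := (_, _)) (d := (_, _))
        (fun k => ?_) (fun k => ?_) (fun k => ?_) _,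
      TsfPair.hasMultiplicity_zeroT (a := (_, _)) (b := (_, _)) (c := (_, _)) (d := (_, _))
        (fun k => ?_) (fun k => ?_) (fun k => ?_) _⟩ <;> dsimp only
    all_goals omega
  · refine TsfPair.hasMultiplicity_zeroTZero (a := (_, _)) (b := (_, _)) (c := (_, _))
      (d := (_, _)) (fun k => ?_) (fun k => ?_) (fun k => ?_) _ <;> dsimp only
    all_goals omega
  · refine ⟨TsfPair.hasMultiplicity_zeroTZero (a := (_, _)) (b := (_, _)) (c := (_, _))
        (d := (_, _)) (fun k => ?_) (fun k => ?_) (fun k => ?_) _,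
      TsfPair.hasMultiplicity_zeroTZero (a := (_, _)) (b := (_, _)) (c := (_, _))
        (d := (_, _)) (fun k => ?_) (fun k => ?_) (fun k => ?_) _⟩ <;> dsimp only
    all_goals omega
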